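/- Let $H_2(p)=-p\log_2 p-(1-p)\log_2(1-p)$ be the binary entropy function, let $H_2^{-1}:[0,1]\to[0,1/2]$ be the inverse of its restriction to $[0,1/2]$, and let $$\kappa_Z(\delta)=\sup_{0<\kappa<1-H_2(\delta)}\kappa\left(1-\frac{\delta}{H_2^{-1}(1-\kappa)}\right)$$ be the rate given by the Zyablov bound (the supremum of the empty set, which occurs for $\delta=1/2$, is $0$). Consider inputs consisting of $n$ binary vectors $x_0,\dots,x_{n-1}\in\{0,1\}^m$, together with two numbers $d_{\min}<d_2$, such that there is a unique pair $\{x_a,x_b\}$ (with $a\neq b$ not known to the algorithm) at the minimum pairwise Hamming distance $d_{\min}$, and $d_2$ is the second minimum distance, that is, the minimum of the Hamming distances of all the other pairs. Put $\delta=d_{\min}/m$ and $\delta'=d_2/m$. Algorithms are programs for a random access machine with logarithmic cost and with fair coin tosses. (a) There is a randomized algorithm which, on every such input, finds the closest pair $\{a,b\}$ with probability at least $1-1/n^2$, and which always halts within time $$O\left(n\log^2 n\cdot 2^{\left(1-\kappa_Z(\delta')-\delta-(1-\delta)H_2\left(\frac{\delta'-\delta}{2(1-\delta)}\right)\right)m}\cdot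 \mathrm{poly}(m)\right).$$ (b) There is a randomized algorithm which, on every such input, and given black box access to a decoder of an arbitrary binary code $C\subseteq\{0,1\}^m$ with minimum distance at least $d=d_2+1$ that meets the Gilbert-Varshamov bound $\frac1m\log_2|C|\ge 1-H_2(d/m)$, finds the closest pair with probability at least $1-1/n^2$ and always halts within time $$O\left(n\log^2 n\cdot 2^{\left(H_2(\delta')-\delta-(1-\delta)H_2\left(\frac{\delta'-\delta}{2(1-\delta)}\right)\right)m}\cdot \mathrm{poly}(m)\right).$$ Here a decoder is a map $\{0,1\}^m\to\{0,1\}^m$ that sends every word within Hamming distance $\lfloor (d-1)/2\rfloor=\lfloor d_2/2\rfloor$ of a codeword to that codeword (its other values are arbitrary), and a call to it is charged only for transferring its $m$-bit argument and value. The implied constants and the polynomials are absolute: they do not depend on $n$, $m$, $d_{\min}$, $d_2$, the vectors, the code or the decoder. -/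

import Mathlib

/-! ### Entropy and the Zyablov bound -/

noncomputable section

/-- The binary entropy function `H₂(p) = -p log₂ p - (1-p) log₂ (1-p)`. -/
def H2 (p : ℝ) : ℝ := Real.binEntropy p / Real.log 2

/-- The inverse of `H₂` restricted to `[0, 1/2]`; on `[0, 1]` it is the genuine inverse. -/
def H2inv (y : ℝ) : ℝ := Function.invFunOn H2 (Set.Icc 0 (1 / 2)) y

/-- The rate given by the Zyablov bound at relative distance `δ`:
the supremum of `κ (1 - δ / H₂⁻¹(1 - κ))` over inner rates `0 < κ < 1 - H₂(δ)`.
It is a maximum for `0 < δ < 1/2`; for `1/2 ≤ δ ≤ 1` its value is `0`. -/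
def kappaZ (δ : ℝ) : ℝ :=
  sSup ((fun κ : ℝ => κ * (1 - δ / H2inv (1 - κ))) '' Set.Ioo 0 (1 - H2 δ))

end

/-! ### Binary vectors, codes, decoders -/

/-- The Hamming cube `{0,1}^m`. -/
abbrev Cube (m : ℕ) : Type := Fin m → Bool

/-- `C` is a binary code of block length `m` in which distinct codewords have distance at
least `d`. -/
def IsCode {m : ℕ} (C : Finset (Cube m)) (d : ℕ) : Prop :=
  ∀ v ∈ C, ∀ w ∈ C, v ≠ w → d ≤ hammingDist v w

/-- The rate `(log₂ |C|) / m`. -/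
noncomputable def codeRate {m : ℕ} (C : Finset (Cube m)) : ℝ :=
  Real.logb 2 (C.card : ℝ) / (m : ℝ)

/-- A nonempty code with designed distance `d` meets the Gilbert-Varshamov bound:
its rate is at least `1 - H₂(d/m)`. -/
def MeetsGV {m : ℕ} (C : Finset (Cube m)) (d : ℕ) : Prop :=
  C.Nonempty ∧ 1 - H2 ((d : ℝ) / (m : ℝ)) ≤ codeRate C

/-- `dec` is a unique decoder for `C` with radius `⌊(d-1)/2⌋`: every word within that distance
of a codeword is sent to this codeword.  On all other words the output of `dec` is arbitrary. -/
def IsUniqueDecoder {m : ℕ} (C : Finset (Cube m)) (d : ℕ) (dec : Cube m → Cube m) : Prop :=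
  ∀ v : Cube m, ∀ w ∈ C, hammingDist v w ≤ (d - 1) / 2 → dec v = w

/-! ### Instances of the Closest Pair Problem -/

/-- Among the `n` vectors `x`, the pair of positions `a < b` is the unique pair at minimum
distance `dmin`, and `d2 > dmin` is the second minimum distance, i.e. the least distance of
all the other pairs. -/
def IsGappedInstance {n m : ℕ} (x : Fin n → Cube m) (a b : Fin n) (dmin d2 : ℕ) : Prop :=
  a < b ∧ hammingDist (x a) (x b) = dmin ∧ dmin < d2 ∧
    IsLeast {d : ℕ | ∃ i j : Fin n, i < j ∧ (i, j) ≠ (a, b) ∧ hammingDist (x i) (x j) = d} d2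

/-! ### The machine model

A random access machine with logarithmic cost, programmed in a structured language.  The machine
has finitely many named registers (those that occur in the program) and an unbounded memory
of cells; both hold natural numbers.  Every operation is charged according to the bit lengths
(`Nat.size`) of the numbers and addresses that it handles.  There is an instruction that tosses a
fair coin, and one that calls a black box on a vector stored in memory. -/

namespace RAM

/-- Binary operations (subtraction is truncated; division and remainder are those of `ℕ`). -/
inductive Op
  | add | sub | mul | div | mod

def Op.eval : Op → ℕ → ℕ → ℕ
  | .add, u, v => u + v
  | .sub, u, v => u - v
  | .mul, u, v => u * v
  | .div, u, v => u / v
  | .mod, u, v => u % v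

/-- Linear cost for addition and subtraction, quadratic (schoolbook) cost for the others. -/
def Op.cost : Op → ℕ → ℕ → ℕ
  | .add, u, v => 1 + u.size + v.size
  | .sub, u, v => 1 + u.size + v.size
  | .mul, u, v => (1 + u.size) * (1 + v.size)
  | .div, u, v => (1 + u.size) * (1 + v.size)
  | .mod, u, v => (1 + u.size) * (1 + v.size)

/-- A state: the registers, the memory, and the number of coins tossed so far. -/
structure State where
  reg : ℕ → ℕ
  mem : ℕ → ℕ
  coins : ℕ

/-- Expressions: constants, registers, memory cells, binary operations. -/
inductive Expr
  | lit (k : ℕ)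
  | reg (r : ℕ)
  | load (addr : Expr)
  | bin (op : Op) (e f : Expr)

def Expr.eval (s : State) : Expr → ℕ
  | .lit k => k
  | .reg r => s.reg r
  | .load e => s.mem (e.eval s)
  | .bin op e f => op.eval (e.eval s) (f.eval s)

def Expr.cost (s : State) : Expr → ℕ
  | .lit k => 1 + k.size
  | .reg r => 1 + (s.reg r).size
  | .load e => e.cost s + 1 + (e.eval s).size + (s.mem (e.eval s)).size
  | .bin op e f => e.cost s + f.cost s + op.cost (e.eval s) (f.eval s)

/-- Programs.  A test `e` succeeds if the value of `e` is not `0`. -/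
inductive Cmd
  | skip
  | assign (r : ℕ) (e : Expr)
  | store (addr e : Expr)
  | flip (r : ℕ)
  | query (src dst : Expr)
  | seq (c c' : Cmd)
  | ite (e : Expr) (c c' : Cmd)
  | loop (e : Expr) (c : Cmd)

/-- The program does not call the black box. -/
def Cmd.OracleFree : Cmd → Prop
  | .skip => True
  | .assign _ _ => True
  | .store _ _ => True
  | .flip _ => True
  | .query _ _ => False
  | .seq c c' => c.OracleFree ∧ c'.OracleFree
  | .ite _ c c' => c.OracleFree ∧ c'.OracleFree
  | .loop _ c => c.OracleFree

/-- Set register `r` to `v`. -/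
def State.setReg (s : State) (r v : ℕ) : State :=
  { s with reg := Function.update s.reg r v }

/-- Set the memory cell with address `i` to `v`. -/
def State.setMem (s : State) (i v : ℕ) : State :=
  { s with mem := Function.update s.mem i v }

/-- The vector stored in the `m` cells from address `i` on (a nonzero cell is read as `1`). -/
def State.readVec (s : State) (m i : ℕ) : Cube m :=
  fun k => decide (s.mem (i + k) ≠ 0)

/-- Write the vector `v` into the `m` cells from address `i` on. -/
def State.writeVec {m : ℕ} (s : State) (i : ℕ) (v : Cube m) : State :=
  { s with mem := fun j =>
      if h : i ≤ j ∧ j - i < m then (v ⟨j - i, h.2⟩).toNat else s.mem j }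

/-- `Exec dec ω c s s' t`: started in state `s`, with black box `dec` and with coin
tosses `ω 0, ω 1, …`, the program `c` halts in state `s'` after time `t`. -/
inductive Exec {m : ℕ} (dec : Cube m → Cube m) (ω : ℕ → Bool) :
    Cmd → State → State → ℕ → Prop
  | skip (s : State) : Exec dec ω .skip s s 1
  | assign (r : ℕ) (e : Expr) (s : State) :
      Exec dec ω (.assign r e) s (s.setReg r (e.eval s)) (e.cost s + 1 + (e.eval s).size)
  | store (f e : Expr) (s : State) :
      Exec dec ω (.store f e) s (s.setMem (f.eval s) (e.eval s))
        (f.cost s + e.cost s + 1 + (f.eval s).size + (e.eval s).size)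
  | flip (r : ℕ) (s : State) :
      Exec dec ω (.flip r) s
        { s.setReg r (ω s.coins).toNat with coins := s.coins + 1 } 2
  | query (f g : Expr) (s : State) :
      Exec dec ω (.query f g) s
        (s.writeVec (g.eval s) (dec (s.readVec m (f.eval s))))
        (f.cost s + g.cost s + 1 + m * (f.eval s + m).size + m * (g.eval s + m).size)
  | seq (c c' : Cmd) (s s' s'' : State) (t t' : ℕ) :
      Exec dec ω c s s' t → Exec dec ω c' s' s'' t' →
      Exec dec ω (.seq c c') s s'' (t + t')
  | iteTrue (e : Expr) (c c' : Cmd) (s s' : State) (t : ℕ) :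
      e.eval s ≠ 0 → Exec dec ω c s s' t →
      Exec dec ω (.ite e c c') s s' (e.cost s + 1 + t)
  | iteFalse (e : Expr) (c c' : Cmd) (s s' : State) (t : ℕ) :
      e.eval s = 0 → Exec dec ω c' s s' t →
      Exec dec ω (.ite e c c') s s' (e.cost s + 1 + t)
  | loopDone (e : Expr) (c : Cmd) (s : State) :
      e.eval s = 0 → Exec dec ω (.loop e c) s s (e.cost s + 1)
  | loopStep (e : Expr) (c : Cmd) (s s' s'' : State) (t t' : ℕ) :
      e.eval s ≠ 0 → Exec dec ω c s s' t → Exec dec ω (.loop e c) s' s'' t' →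
      Exec dec ω (.loop e c) s s'' (e.cost s + 1 + t + t')

/-- The initial state: registers `0, 1, 2, 3` hold `n, m, dmin, d2`, the memory
cell `i * m + k` holds the `k`-th bit of the `i`-th vector, everything else is `0`. -/
def initState {n m : ℕ} (x : Fin n → Cube m) (dmin d2 : ℕ) : State where
  reg := fun r =>
    if r = 0 then n else if r = 1 then m else if r = 2 then dmin else if r = 3 then d2 else 0
  mem := fun j =>
    if h : j < n * m then
      (x (Fin.divNat (⟨j, h⟩ : Fin (n * m))) (Fin.modNat (⟨j, h⟩ : Fin (n * m)))).toNat
    else 0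
  coins := 0

/-- The output, in registers `0` and `1`, is the pair of positions `{a, b}`. -/
def Outputs (s : State) (a b : ℕ) : Prop :=
  (s.reg 0 = a ∧ s.reg 1 = b) ∨ (s.reg 0 = b ∧ s.reg 1 = a)

/-- The law of an infinite sequence of independent fair coin tosses. -/
noncomputable def coinLaw : MeasureTheory.Measure (ℕ → Bool) :=
  MeasureTheory.Measure.infinitePi fun _ : ℕ => (PMF.uniformOfFintype Bool).toMeasure

/-- On input `x, dmin, d2`, and with black box `dec`, the program `P` halts within time `T`
whatever the coin tosses are, and with probability at least `1 - 1/n²` it outputs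
the pair `{a, b}`. -/
def FindsPair {n m : ℕ} (dec : Cube m → Cube m) (P : Cmd) (x : Fin n → Cube m)
    (a b : Fin n) (dmin d2 : ℕ) (T : ℝ) : Prop :=
  (∀ ω : ℕ → Bool, ∃ (s : State) (t : ℕ),
    Exec dec ω P (initState x dmin d2) s t ∧ (t : ℝ) ≤ T) ∧
  1 - 1 / (n : ℝ) ^ 2 ≤
    coinLaw.real {ω : ℕ → Bool | ∃ (s : State) (t : ℕ),
      Exec dec ω P (initState x dmin d2) s t ∧ Outputs s a b}

end RAM

/-- `δ + (1-δ) H₂((δ'-δ) / (2(1-δ)))`. -/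
noncomputable def midExponent (δ δ' : ℝ) : ℝ :=
  δ + (1 - δ) * H2 ((δ' - δ) / (2 * (1 - δ)))

/-- `A · n (log₂ n)² · 2^{γ m} · m^k`. -/
noncomputable def timeBound (A k : ℕ) (γ : ℝ) (n m : ℕ) : ℝ :=
  (A : ℝ) * ((n : ℝ) * Real.logb 2 (n : ℝ) ^ 2 * (2 : ℝ) ^ (γ * (m : ℝ)) * (m : ℝ) ^ k)

/-! ### Entropy and binomial coefficients -/

/-! Write `d` for `dmin` and `u = min m (2 * d2 - 1)`. Both parts are proved with one program. A
repetition draws a random set of `u` coordinates, ignores them, and compares all pairs of vectors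
that agree on the remaining ones.

Comparisons are cheap. Vectors in a common bucket differ only inside fewer than `2 * d2`
coordinates, and after removal of one endpoint of the closest pair all their distances are at least
`d2`. The Plotkin averaging argument (`card_le_of_agree_off`, `IsGappedInstance.card_bucket_le`)
then leaves at most `2 * d2 + 1` vectors in a bucket, so a repetition costs `n` times a polynomial
in `m`.

Success is likely enough. The closest pair falls into one bucket as soon as the selection covers its
`d` differing coordinates. With truly uniform selection this has probability `(u)_d / (m)_d`, a
quotient of falling factorials; drawing the selection from `m * m` coins loses at most a factor `2`
(`mul_descFactorial_le_card_subset_selSet`). About `4 (m + 1) (m)_d / (u)_d` repetitions push the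
failure probability below `exp (-2 (m + 1))`, which is at most `1 / n ^ 2` because `n ≤ 2 ^ m + 1`.

It remains to bound `(m)_d / (u)_d` by `2 (m + 1) 2 ^ (γ m)`. If `2 * d2 ≤ m`, the identity `C(m,
d2) C(d2, d) = C(m, d) C(m - d, d2 - d)`, the entropy estimates of binomial coefficients and `2 ^ d
(d2)_d ≤ 2 (2 d2 - 1)_d` give this for the exponent of part (b) (`descFactorial_le_exponent`). The
exponent of part (a) is no smaller, since the Zyablov rate is at most `1 - H2 δ'`. If `m < 2 * d2`,
then `u = m` and the ratio is `1`, so the exponent only has to be not too negative. In (a) it is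
nonnegative, because the Zyablov rate is at most `0` there; in (b) the Plotkin bound says that a
code of this distance has at most `2 (m + 1)` words, and meeting the Gilbert-Varshamov bound then
limits how negative the exponent can be.

The rest is bookkeeping on the machine: each loop has an invariant and a time bound in elementary
steps on numbers of `O(m ^ 2)` bits. -/

theorem choose_mul_pow_le_succ {N k i : ℕ} (hk : k ≤ N) (hi : i < k) :
    N.choose i * k ^ i * (N - k) ^ (N - i)
      ≤ N.choose (i + 1) * k ^ (i + 1) * (N - k) ^ (N - (i + 1)) := by
  have h1 : N.choose (i + 1) * (i + 1) = N.choose i * (N - i) := Nat.choose_succ_right_eq N i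
  have h2 : (i + 1) * (N - k) ≤ (N - i) * k := by
    rw [mul_comm (N - i)]
    exact Nat.mul_le_mul hi (by omega)
  have h3 : N - i = N - (i + 1) + 1 := by omega
  refine Nat.le_of_mul_le_mul_left ?_ (Nat.add_one_pos i)
  calc (i + 1) * (N.choose i * k ^ i * (N - k) ^ (N - i))
      = (N.choose i * k ^ i * (N - k) ^ (N - (i + 1))) * ((i + 1) * (N - k)) := by
        conv_lhs => rw [h3, pow_succ]
        ring
    _ ≤ (N.choose i * k ^ i * (N - k) ^ (N - (i + 1))) * ((N - i) * k) :=
        Nat.mul_le_mul_left _ h2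
    _ = (N.choose i * (N - i)) * (k ^ (i + 1) * (N - k) ^ (N - (i + 1))) := by ring
    _ = _ := by rw [← h1]; ring

theorem choose_mul_pow_succ_le {N k i : ℕ} (hi : k ≤ i) (hN : i < N) :
    N.choose (i + 1) * k ^ (i + 1) * (N - k) ^ (N - (i + 1))
      ≤ N.choose i * k ^ i * (N - k) ^ (N - i) := by
  have h1 : N.choose (i + 1) * (i + 1) = N.choose i * (N - i) := Nat.choose_succ_right_eq N i
  have h2 : (N - i) * k ≤ (i + 1) * (N - k) := by
    rw [mul_comm (N - i)]
    exact Nat.mul_le_mul (by omega) (by omega)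
  have h3 : N - i = N - (i + 1) + 1 := by omega
  refine Nat.le_of_mul_le_mul_left ?_ (Nat.add_one_pos i)
  calc (i + 1) * (N.choose (i + 1) * k ^ (i + 1) * (N - k) ^ (N - (i + 1)))
      = (N.choose (i + 1) * (i + 1)) * (k ^ (i + 1) * (N - k) ^ (N - (i + 1))) := by ring
    _ = (N.choose i * k ^ i * (N - k) ^ (N - (i + 1))) * ((N - i) * k) := by rw [h1]; ring
    _ ≤ (N.choose i * k ^ i * (N - k) ^ (N - (i + 1))) * ((i + 1) * (N - k)) :=
        Nat.mul_le_mul_left _ h2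
    _ = _ := by
        conv_rhs => rw [h3, pow_succ]
        ring

/-- The mode of the binomial distribution with parameters `N` and `k / N` is `k`. -/
theorem choose_mul_pow_le_mode {N k i : ℕ} (hk : k ≤ N) (hi : i ≤ N) :
    N.choose i * k ^ i * (N - k) ^ (N - i) ≤ N.choose k * k ^ k * (N - k) ^ (N - k) := by
  rcases le_total i k with h | h
  · induction h using Nat.decreasingInduction with
    | self => exact le_rfl
    | of_succ j hj ih => exact (choose_mul_pow_le_succ hk hj).trans (ih (by omega))
  · induction i, h using Nat.le_induction with
    | base => exact le_rfl
    | succ j hj ih => exact (choose_mul_pow_succ_le hj (by omega)).trans (ih (by omega))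

theorem choose_mul_pow_le_pow {N k : ℕ} (hk : k ≤ N) :
    N.choose k * k ^ k * (N - k) ^ (N - k) ≤ N ^ N := by
  have h := add_pow k (N - k) N
  rw [Nat.add_sub_cancel' hk] at h
  rw [h]
  have := Finset.single_le_sum (f := fun i => k ^ i * (N - k) ^ (N - i) * N.choose i)
    (fun _ _ => Nat.zero_le _) (Finset.mem_range.2 (Nat.lt_succ_of_le hk))
  calc _ = k ^ k * (N - k) ^ (N - k) * N.choose k := by ring
    _ ≤ _ := by simpa using this

/-- `N ^ N` is the sum of the `N + 1` terms of the expansion of `(k + (N - k)) ^ N`, and the term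
with index `k` is the largest. -/
theorem pow_le_choose_mul_pow {N k : ℕ} (hk : k ≤ N) :
    N ^ N ≤ (N + 1) * (N.choose k * k ^ k * (N - k) ^ (N - k)) := by
  have h := add_pow k (N - k) N
  rw [Nat.add_sub_cancel' hk] at h
  rw [h]
  calc _ ≤ ∑ _i ∈ Finset.range (N + 1), N.choose k * k ^ k * (N - k) ^ (N - k) := by
        refine Finset.sum_le_sum fun i hi => ?_
        have := choose_mul_pow_le_mode hk (Nat.lt_succ_iff.1 (Finset.mem_range.1 hi))
        calc _ = N.choose i * k ^ i * (N - k) ^ (N - i) := by push_cast; ring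
          _ ≤ _ := this
    _ = _ := by simp

/-- Stated without division by `a ^ a`, so that `0 ^ 0 = 1` covers `a = 0` and the endpoints of the
entropy need no separate treatment later. -/
theorem exp_mul_log_div {a b : ℕ} (hb : 0 < b) :
    Real.exp ((a : ℝ) * Real.log ((a : ℝ) / b)⁻¹) * (a : ℝ) ^ a = (b : ℝ) ^ a := by
  rcases Nat.eq_zero_or_pos a with rfl | ha
  · simp
  have ha' : (0 : ℝ) < a := by exact_mod_cast ha
  have hb' : (0 : ℝ) < b := by exact_mod_cast hb
  rw [Real.exp_nat_mul, Real.exp_log (by positivity), ← mul_pow]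
  congr 1
  field_simp

theorem exp_mul_binEntropy {N k : ℕ} (hN : 0 < N) (hk : k ≤ N) :
    Real.exp ((N : ℝ) * Real.binEntropy ((k : ℝ) / N)) * ((k : ℝ) ^ k * ((N - k : ℕ) : ℝ) ^ (N - k))
      = (N : ℝ) ^ N := by
  have hN' : (N : ℝ) ≠ 0 := by positivity
  have h1 : 1 - (k : ℝ) / N = ((N - k : ℕ) : ℝ) / N := by
    rw [Nat.cast_sub hk]; field_simp
  have h2 : (N : ℝ) * Real.binEntropy ((k : ℝ) / N) =
      (k : ℝ) * Real.log ((k : ℝ) / N)⁻¹ +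
        ((N - k : ℕ) : ℝ) * Real.log (((N - k : ℕ) : ℝ) / N)⁻¹ := by
    unfold Real.binEntropy
    rw [h1]; field_simp
  rw [h2, Real.exp_add]
  calc _ = (Real.exp ((k : ℝ) * Real.log ((k : ℝ) / N)⁻¹) * (k : ℝ) ^ k) *
        (Real.exp (((N - k : ℕ) : ℝ) * Real.log (((N - k : ℕ) : ℝ) / N)⁻¹) *
          ((N - k : ℕ) : ℝ) ^ (N - k)) := by ring
    _ = (N : ℝ) ^ k * (N : ℝ) ^ (N - k) := by rw [exp_mul_log_div hN, exp_mul_log_div hN]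
    _ = _ := by rw [← pow_add, Nat.add_sub_cancel' hk]

theorem two_rpow_H2_mul (p x : ℝ) : (2 : ℝ) ^ (H2 p * x) = Real.exp (x * Real.binEntropy p) := by
  have h : Real.log 2 ≠ 0 := (Real.log_pos one_lt_two).ne'
  rw [Real.rpow_def_of_pos two_pos, H2]
  congr 1
  field_simp

theorem choose_le_two_rpow {N k : ℕ} (hk : k ≤ N) :
    (N.choose k : ℝ) ≤ 2 ^ (H2 ((k : ℝ) / N) * N) := by
  rcases Nat.eq_zero_or_pos N with rfl | hN
  · obtain rfl : k = 0 := by omega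
    simp
  rw [two_rpow_H2_mul]
  have h1 := exp_mul_binEntropy hN hk
  have h2 : (N.choose k : ℝ) * ((k : ℝ) ^ k * ((N - k : ℕ) : ℝ) ^ (N - k)) ≤ (N : ℝ) ^ N := by
    rw [← mul_assoc]
    exact_mod_cast choose_mul_pow_le_pow hk
  rw [← h1] at h2
  refine le_of_mul_le_mul_right h2 ?_
  have h3 : 0 < k ^ k * (N - k) ^ (N - k) := Nat.mul_pos Nat.pow_self_pos Nat.pow_self_pos
  exact_mod_cast h3

theorem two_rpow_le_choose {N k : ℕ} (hk : k ≤ N) :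
    (2 : ℝ) ^ (H2 ((k : ℝ) / N) * N) ≤ (N + 1) * N.choose k := by
  rcases Nat.eq_zero_or_pos N with rfl | hN
  · obtain rfl : k = 0 := by omega
    simp
  rw [two_rpow_H2_mul]
  have h1 := exp_mul_binEntropy hN hk
  have h2 : (N : ℝ) ^ N ≤
      ((N + 1) * N.choose k : ℝ) * ((k : ℝ) ^ k * ((N - k : ℕ) : ℝ) ^ (N - k)) := by
    have := pow_le_choose_mul_pow hk
    calc (N : ℝ) ^ N
        ≤ (N + 1) * (N.choose k * (k : ℝ) ^ k * ((N - k : ℕ) : ℝ) ^ (N - k)) := by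
          exact_mod_cast this
      _ = _ := by ring
  rw [← h1] at h2
  refine le_of_mul_le_mul_right h2 ?_
  have h3 : 0 < k ^ k * (N - k) ^ (N - k) := Nat.mul_pos Nat.pow_self_pos Nat.pow_self_pos
  exact_mod_cast h3

/-! ### Range and monotonicity of the entropy, and the resulting exponent bounds -/

theorem H2_le_one (p : ℝ) : H2 p ≤ 1 := by
  rw [H2, div_le_one (Real.log_pos one_lt_two)]
  exact Real.binEntropy_le_log_two

theorem H2_nonneg {p : ℝ} (h0 : 0 ≤ p) (h1 : p ≤ 1) : 0 ≤ H2 p :=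
  div_nonneg (Real.binEntropy_nonneg h0 h1) (Real.log_pos one_lt_two).le

theorem H2_mono {p q : ℝ} (h0 : 0 ≤ p) (hpq : p ≤ q) (hq : q ≤ 1 / 2) : H2 p ≤ H2 q := by
  have hq' : q ≤ 2⁻¹ := by linarith
  exact div_le_div_of_nonneg_right
    (Real.binEntropy_strictMonoOn.monotoneOn ⟨h0, hpq.trans hq'⟩ ⟨h0.trans hpq, hq'⟩ hpq)
    (Real.log_pos one_lt_two).le

/-- The argument `q` may exceed `1`, where the entropy is nonpositive. This is needed for `(d2 + 1)
/ m` when `d2 = m`. -/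
theorem H2_anti {p q : ℝ} (hp : 1 / 2 ≤ p) (hpq : p ≤ q) (hp1 : p ≤ 1) : H2 q ≤ H2 p := by
  have hp' : 2⁻¹ ≤ p := by linarith
  refine div_le_div_of_nonneg_right ?_ (Real.log_pos one_lt_two).le
  rcases le_total q 1 with hq | hq
  · exact Real.binEntropy_strictAntiOn.antitoneOn ⟨hp', hp1⟩ ⟨hp'.trans hpq, hq⟩ hpq
  · exact (Real.binEntropy_nonpos_of_one_le hq).trans
      (Real.binEntropy_nonneg (by linarith) hp1)

theorem midExponent_le_one {δ δ' : ℝ} (h1 : δ ≤ 1) : midExponent δ δ' ≤ 1 := by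
  have h := mul_le_mul_of_nonneg_left (H2_le_one ((δ' - δ) / (2 * (1 - δ)))) (sub_nonneg.2 h1)
  rw [midExponent]
  linarith

/-- `2^{mid · m} ≤ (m + 1) 2^{dmin} C(m - dmin, d2 - dmin)`. -/
theorem two_rpow_midExponent_le {m dmin d2 : ℕ} (h : dmin < d2) (hm : 2 * d2 ≤ m) :
    (2 : ℝ) ^ (midExponent ((dmin : ℝ) / m) ((d2 : ℝ) / m) * m) ≤
      (m + 1) * (2 ^ dmin * (m - dmin).choose (d2 - dmin)) := by
  have hm0 : (0 : ℝ) < m := by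
    have : 0 < m := by omega
    exact_mod_cast this
  have hM : (0 : ℝ) < ((m - dmin : ℕ) : ℝ) := by
    have : 0 < m - dmin := by omega
    exact_mod_cast this
  have hMe : ((m - dmin : ℕ) : ℝ) = m - dmin := Nat.cast_sub (by omega)
  have hDe : ((d2 - dmin : ℕ) : ℝ) = d2 - dmin := Nat.cast_sub (by omega)
  have harg : ((d2 : ℝ) / m - (dmin : ℝ) / m) / (2 * (1 - (dmin : ℝ) / m)) =
      ((d2 - dmin : ℕ) : ℝ) / (2 * ((m - dmin : ℕ) : ℝ)) := by
    rw [hMe, hDe]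
    rw [hMe] at hM
    field_simp
  -- The factor `1/2` in the argument of the entropy can be dropped: by `2 * d2 ≤ m` the larger
  -- argument is still at most `1/2`, where the entropy increases.
  have hH : H2 (((d2 - dmin : ℕ) : ℝ) / (2 * ((m - dmin : ℕ) : ℝ))) ≤
      H2 (((d2 - dmin : ℕ) : ℝ) / ((m - dmin : ℕ) : ℝ)) := by
    apply H2_mono (by positivity)
    · gcongr
      linarith
    · rw [div_le_div_iff₀ hM two_pos]
      have : (d2 - dmin) * 2 ≤ 1 * (m - dmin) := by omega
      exact_mod_cast this
  have hmid : midExponent ((dmin : ℝ) / m) ((d2 : ℝ) / m) * m =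
      dmin + H2 (((d2 - dmin : ℕ) : ℝ) / (2 * ((m - dmin : ℕ) : ℝ))) * ((m - dmin : ℕ) : ℝ) := by
    rw [midExponent, harg]
    generalize H2 _ = z
    rw [hMe]
    field_simp
  rw [hmid, Real.rpow_add two_pos, Real.rpow_natCast]
  have hk : d2 - dmin ≤ m - dmin := by omega
  calc _ ≤ (2 : ℝ) ^ dmin *
        2 ^ (H2 (((d2 - dmin : ℕ) : ℝ) / ((m - dmin : ℕ) : ℝ)) * ((m - dmin : ℕ) : ℝ)) := by
        gcongr
        norm_num
    _ ≤ (2 : ℝ) ^ dmin * ((((m - dmin : ℕ) : ℝ) + 1) * (m - dmin).choose (d2 - dmin)) := by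
        gcongr
        exact two_rpow_le_choose hk
    _ ≤ (2 : ℝ) ^ dmin * (((m : ℝ) + 1) * (m - dmin).choose (d2 - dmin)) := by
        gcongr
        omega
    _ = _ := by ring

/-- Counting pairs of a `dmin`-set inside a `d2`-set in two ways expresses `C(m, dmin)` by `C(m,
d2)`, which has exponent `H2 δ'`, and `C(m - dmin, d2 - dmin)`, whose exponent supplies the middle
term. -/
theorem choose_le_exponent {m dmin d2 : ℕ} (h : dmin < d2) (hm : 2 * d2 ≤ m) :
    (m.choose dmin : ℝ) ≤ (m + 1) * (2 ^ dmin * d2.choose dmin) *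
      2 ^ ((H2 ((d2 : ℝ) / m) - midExponent ((dmin : ℝ) / m) ((d2 : ℝ) / m)) * m) := by
  have h1 := two_rpow_midExponent_le h hm
  have h2 : (m.choose d2 : ℝ) ≤ 2 ^ (H2 ((d2 : ℝ) / m) * m) := choose_le_two_rpow (by omega)
  have h3 : (m.choose d2 : ℝ) * d2.choose dmin =
      m.choose dmin * (m - dmin).choose (d2 - dmin) := by
    exact_mod_cast Nat.choose_mul (n := m) h.le
  rw [sub_mul, Real.rpow_sub two_pos, mul_div_assoc', le_div_iff₀ (by positivity)]
  calc (m.choose dmin : ℝ) * 2 ^ (midExponent ((dmin : ℝ) / m) ((d2 : ℝ) / m) * m)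
      ≤ m.choose dmin * ((m + 1) * (2 ^ dmin * (m - dmin).choose (d2 - dmin))) := by gcongr
    _ = (m + 1) * 2 ^ dmin * (m.choose dmin * (m - dmin).choose (d2 - dmin)) := by ring
    _ = (m + 1) * (2 ^ dmin * d2.choose dmin) * m.choose d2 := by rw [← h3]; ring
    _ ≤ _ := by gcongr

/-- Compare factor by factor: `2 (k - j) ≤ 2 k - 1 - j` for `j ≥ 1`, and the factor with `j = 0`
costs the extra `2`. -/
theorem two_pow_mul_descFactorial_le {k : ℕ} (hk : 1 ≤ k) (d : ℕ) :
    2 ^ d * k.descFactorial d ≤ 2 * (2 * k - 1).descFactorial d := by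
  induction d with
  | zero => simp
  | succ d ih =>
    rw [Nat.descFactorial_succ, Nat.descFactorial_succ]
    rcases Nat.eq_zero_or_pos d with rfl | hd
    · simp; omega
    calc 2 ^ (d + 1) * ((k - d) * k.descFactorial d)
        = (2 * (k - d)) * (2 ^ d * k.descFactorial d) := by ring
      _ ≤ (2 * k - 1 - d) * (2 * (2 * k - 1).descFactorial d) :=
          Nat.mul_le_mul (by omega) ih
      _ = _ := by ring

/-- The quotient of the two falling factorials is the inverse of the probability that a uniform set
of `2 * d2 - 1` coordinates covers `dmin` given ones. Selecting almost `2 * d2` coordinates instead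
of `d2` absorbs the factor `2 ^ dmin`. -/
theorem descFactorial_le_exponent {m dmin d2 : ℕ} (h : dmin < d2) (hm : 2 * d2 ≤ m) :
    (m.descFactorial dmin : ℝ) ≤ 2 * (m + 1) * (2 * d2 - 1).descFactorial dmin *
      2 ^ ((H2 ((d2 : ℝ) / m) - midExponent ((dmin : ℝ) / m) ((d2 : ℝ) / m)) * m) := by
  have h1 := choose_le_exponent h hm
  have h2 : (2 : ℝ) ^ dmin * d2.descFactorial dmin ≤ 2 * (2 * d2 - 1).descFactorial dmin := by
    exact_mod_cast two_pow_mul_descFactorial_le (by omega : 1 ≤ d2) dmin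
  rw [Nat.descFactorial_eq_factorial_mul_choose d2] at h2
  rw [Nat.descFactorial_eq_factorial_mul_choose m]
  push_cast at h2 ⊢
  set z := (2 : ℝ) ^ ((H2 ((d2 : ℝ) / m) - midExponent ((dmin : ℝ) / m) ((d2 : ℝ) / m)) * m)
  calc (dmin.factorial : ℝ) * m.choose dmin
      ≤ dmin.factorial * ((m + 1) * (2 ^ dmin * d2.choose dmin) * z) := by gcongr
    _ = (m + 1) * z * (2 ^ dmin * (dmin.factorial * d2.choose dmin)) := by ring
    _ ≤ (m + 1) * z * (2 * (2 * d2 - 1).descFactorial dmin) := by gcongr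
    _ = _ := by ring

/-! ### The Zyablov rate -/

theorem H2inv_spec {y : ℝ} (h0 : 0 ≤ y) (h1 : y ≤ 1) :
    H2inv y ∈ Set.Icc (0 : ℝ) (1 / 2) ∧ H2 (H2inv y) = y := by
  have hex : ∃ a ∈ Set.Icc (0 : ℝ) (1 / 2), H2 a = y := by
    have hc : ContinuousOn H2 (Set.Icc (0 : ℝ) (1 / 2)) :=
      (Real.binEntropy_continuous.div_const _).continuousOn
    have := intermediate_value_Icc (by norm_num) hc
    have hz : H2 0 = 0 := by simp [H2]
    have ho : H2 (1 / 2) = 1 := by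
      rw [H2, one_div, Real.binEntropy_two_inv, div_self (Real.log_pos one_lt_two).ne']
    rw [hz, ho] at this
    exact this ⟨h0, h1⟩
  exact ⟨Function.invFunOn_mem hex, Function.invFunOn_eq hex⟩

/-- The factor next to `κ` is at most `1`, and `κ` stays below `1 - H2 δ`. -/
theorem kappaZ_le {δ : ℝ} (h0 : 0 ≤ δ) (h1 : δ ≤ 1) : kappaZ δ ≤ 1 - H2 δ := by
  -- The bound must be nonnegative since the supremum of the empty set is `0`.
  refine Real.sSup_le ?_ (sub_nonneg.2 (H2_le_one δ))
  rintro _ ⟨κ, ⟨hκ0, hκ1⟩, rfl⟩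
  have hH := H2_nonneg h0 h1
  have := (H2inv_spec (y := 1 - κ) (by linarith) (by linarith)).1.1
  have h2 : 0 ≤ δ / H2inv (1 - κ) := div_nonneg h0 this
  have := mul_nonneg hκ0.le h2
  simp only
  linarith

/-- Here `δ ≥ 1/2 ≥ H2inv (1 - κ)`, so every term is nonpositive. The denominator is not `0`,
because `1 - κ > H2 δ ≥ 0`. -/
theorem kappaZ_nonpos {δ : ℝ} (h0 : 1 / 2 ≤ δ) (h1 : δ ≤ 1) : kappaZ δ ≤ 0 := by
  refine Real.sSup_le ?_ le_rfl
  rintro _ ⟨κ, ⟨hκ0, hκ1⟩, rfl⟩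
  have hH := H2_nonneg (by linarith) h1
  obtain ⟨⟨hi0, hi1⟩, hi⟩ := H2inv_spec (y := 1 - κ) (by linarith) (by linarith)
  have hne : H2inv (1 - κ) ≠ 0 := by
    intro h
    rw [h] at hi
    simp [H2] at hi
    linarith
  have hpos : 0 < H2inv (1 - κ) := lt_of_le_of_ne hi0 (Ne.symm hne)
  have h2 : 1 ≤ δ / H2inv (1 - κ) := by
    rw [one_le_div hpos]; linarith
  exact mul_nonpos_of_nonneg_of_nonpos hκ0.le (by linarith)

/-! ### The Plotkin bound -/

/-- A coordinate that splits the words into classes of sizes `A` and `B` separates `2 A B` ordered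
pairs, and `4 A B ≤ (A + B) ^ 2`. -/
theorem card_ne_pairs_le {ι : Type*} (I : Finset ι) (f : ι → Bool) :
    2 * ∑ i ∈ I, ∑ j ∈ I, (if f i ≠ f j then 1 else 0) ≤ I.card ^ 2 := by
  set A := I.filter fun i => f i = true
  set B := I.filter fun i => ¬ f i = true
  have hAB : A.card + B.card = I.card := Finset.card_filter_add_card_filter_not _
  have h1 : ∑ i ∈ I, ∑ j ∈ I, (if f i ≠ f j then 1 else 0) =
      ∑ i ∈ I, (if f i = true then B.card else A.card) := by
    refine Finset.sum_congr rfl fun i _ => ?_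
    rw [← Finset.card_filter]
    split_ifs with h
    · congr 1
      refine Finset.filter_congr fun j _ => ?_
      rw [h]; tauto
    · congr 1
      refine Finset.filter_congr fun j _ => ?_
      rw [Bool.not_eq_true] at h
      rw [h]
      cases f j <;> simp
  rw [h1, Finset.sum_ite, Finset.sum_const, Finset.sum_const, smul_eq_mul, smul_eq_mul, ← hAB]
  linarith [four_mul_le_sq_add A.card B.card, mul_comm A.card B.card]

/-- Words with pairwise distance at least `d` that agree outside fewer than `2 d` positions:
there are at most `2 d` of them. -/
theorem card_le_of_agree_off {ι : Type*} {m d : ℕ} (I : Finset ι) (x : ι → Cube m)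
    (U : Finset (Fin m)) (hU : U.card < 2 * d)
    (hd : ∀ i ∈ I, ∀ j ∈ I, i ≠ j → d ≤ hammingDist (x i) (x j))
    (hoff : ∀ i ∈ I, ∀ j ∈ I, ∀ k ∉ U, x i k = x j k) : I.card ≤ 2 * d := by
  classical
  rcases I.eq_empty_or_nonempty with rfl | hne
  · simp
  have hpos : 0 < I.card := hne.card_pos
  have hdist : ∀ i ∈ I, ∀ j ∈ I,
      hammingDist (x i) (x j) = ∑ k ∈ U, (if x i k ≠ x j k then 1 else 0) := by
    intro i hi j hj
    rw [← Finset.card_filter, hammingDist]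
    congr 1
    ext k
    simp only [Finset.mem_filter, Finset.mem_univ, true_and]
    refine ⟨fun h => ⟨?_, h⟩, fun h => h.2⟩
    by_contra hk
    exact h (hoff i hi j hj k hk)
  -- Double counting of the total distance over ordered pairs: from below pair by pair, from above
  -- coordinate by coordinate.
  have hlow : I.card * ((I.card - 1) * d) ≤ ∑ i ∈ I, ∑ j ∈ I, hammingDist (x i) (x j) := by
    rw [← smul_eq_mul (a := I.card), ← Finset.sum_const]
    refine Finset.sum_le_sum fun i hi => ?_
    calc (I.card - 1) * d = ∑ _j ∈ I.erase i, d := by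
          rw [Finset.sum_const, Finset.card_erase_of_mem hi, smul_eq_mul]
      _ ≤ ∑ j ∈ I.erase i, hammingDist (x i) (x j) :=
          Finset.sum_le_sum fun j hj => hd i hi j (Finset.mem_of_mem_erase hj)
            (Finset.ne_of_mem_erase hj).symm
      _ ≤ _ := Finset.sum_le_sum_of_subset (Finset.erase_subset _ _)
  have hup : 2 * ∑ i ∈ I, ∑ j ∈ I, hammingDist (x i) (x j) ≤ U.card * I.card ^ 2 := by
    calc 2 * ∑ i ∈ I, ∑ j ∈ I, hammingDist (x i) (x j)
        = 2 * ∑ i ∈ I, ∑ j ∈ I, ∑ k ∈ U, (if x i k ≠ x j k then 1 else 0) := by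
          congr 1
          exact Finset.sum_congr rfl fun i hi => Finset.sum_congr rfl fun j hj => hdist i hi j hj
      _ = ∑ k ∈ U, 2 * ∑ i ∈ I, ∑ j ∈ I, (if x i k ≠ x j k then 1 else 0) := by
          rw [← Finset.mul_sum]
          congr 1
          rw [Finset.sum_comm]
          rw [Finset.sum_congr rfl fun i _ => Finset.sum_comm]
          rw [Finset.sum_comm]
          exact Finset.sum_congr rfl fun k _ => Finset.sum_comm
      _ ≤ ∑ _k ∈ U, I.card ^ 2 := Finset.sum_le_sum fun k _ => card_ne_pairs_le I fun i => x i k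
      _ = _ := by simp
  obtain ⟨N, hN⟩ : ∃ N, I.card = N + 1 := ⟨I.card - 1, by omega⟩
  rw [hN] at hlow hup ⊢
  rw [Nat.add_sub_cancel] at hlow
  have h1 : 2 * ((N + 1) * (N * d)) ≤ U.card * (N + 1) ^ 2 :=
    (Nat.mul_le_mul_left 2 hlow).trans hup
  have h2 : 2 * (N * d) ≤ U.card * (N + 1) := by
    refine Nat.le_of_mul_le_mul_left ?_ (Nat.add_one_pos N)
    calc (N + 1) * (2 * (N * d)) = 2 * ((N + 1) * (N * d)) := by ring
      _ ≤ _ := h1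
      _ = _ := by ring
  -- With `U.card ≤ 2 * d - 1` this turns `2 d N ≤ U.card (N + 1)` into `N + 1 ≤ 2 d`.
  have h3 : (U.card + 1) * (N + 1) ≤ 2 * d * (N + 1) := Nat.mul_le_mul_right _ hU
  nlinarith

theorem IsCode.card_le {m d : ℕ} {C : Finset (Cube m)} (hC : IsCode C d) (hd : m < 2 * d) :
    C.card ≤ 2 * d :=
  card_le_of_agree_off C id Finset.univ (by simpa using hd) hC
    fun _ _ _ _ k hk => absurd (Finset.mem_univ k) hk

/-! ### Gapped instances -/

section Instance

variable {n m : ℕ} {x : Fin n → Cube m} {a b : Fin n} {dmin d2 : ℕ}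

theorem IsGappedInstance.le_dist (h : IsGappedInstance x a b dmin d2) {i j : Fin n} (hij : i ≠ j)
    (hne : ¬ ((i = a ∧ j = b) ∨ (i = b ∧ j = a))) : d2 ≤ hammingDist (x i) (x j) := by
  obtain ⟨-, -, -, -, hl⟩ := h
  rcases lt_or_gt_of_ne hij with hlt | hlt
  · refine hl ⟨i, j, hlt, fun he => hne (Or.inl ?_), rfl⟩
    simpa using he
  · refine hl ⟨j, i, hlt, fun he => hne (Or.inr ?_), hammingDist_comm _ _⟩
    simp only [Prod.mk.injEq] at he
    exact ⟨he.2, he.1⟩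

theorem IsGappedInstance.eq_of_dist_le (h : IsGappedInstance x a b dmin d2) {i j : Fin n}
    (hij : i ≠ j) (hd : hammingDist (x i) (x j) ≤ dmin) :
    (i = a ∧ j = b) ∨ (i = b ∧ j = a) := by
  by_contra hne
  have := h.le_dist hij hne
  have := h.2.2.1
  omega

theorem IsGappedInstance.d2_le (h : IsGappedInstance x a b dmin d2) : d2 ≤ m := by
  obtain ⟨i, j, -, -, hd⟩ := h.2.2.2.1
  rw [← hd]
  simpa using hammingDist_le_card_fintype (x := x i) (y := x j)

theorem IsGappedInstance.two_lt (h : IsGappedInstance x a b dmin d2) : 2 < n := by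
  obtain ⟨i, j, hij, hne, -⟩ := h.2.2.2.1
  have hab := h.1
  by_contra hn
  apply hne
  rw [Fin.lt_def] at hij hab
  have := a.2; have := b.2; have := i.2; have := j.2
  rw [Prod.mk.injEq, Fin.ext_iff, Fin.ext_iff]
  omega

/-- Without `b` all distances are at least `d2 > 0`, so the remaining vectors are distinct. Only one
coincidence, between `a` and `b`, is possible. -/
theorem IsGappedInstance.card_le_two_pow (h : IsGappedInstance x a b dmin d2) :
    n ≤ 2 ^ m + 1 := by
  classical
  have h1 : (Finset.univ.erase b).card ≤ (Finset.univ : Finset (Cube m)).card := by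
    refine Finset.card_le_card_of_injOn x (fun _ _ => Finset.mem_coe.2 (Finset.mem_univ _)) ?_
    intro i hi j hj hij
    by_contra hne
    have hi' : i ≠ b := Finset.ne_of_mem_erase hi
    have hj' : j ≠ b := Finset.ne_of_mem_erase hj
    have := h.le_dist hne (by tauto)
    rw [hij, hammingDist_self] at this
    have := h.2.2.1
    omega
  rw [Finset.card_erase_of_mem (Finset.mem_univ b)] at h1
  simp at h1
  omega

/-- In a gapped instance at most `2 d2 + 1` vectors agree outside fewer than `2 d2` positions. -/
theorem IsGappedInstance.card_bucket_le (h : IsGappedInstance x a b dmin d2)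
    (I : Finset (Fin n)) (U : Finset (Fin m)) (hU : U.card < 2 * d2)
    (hoff : ∀ i ∈ I, ∀ j ∈ I, ∀ k ∉ U, x i k = x j k) : I.card ≤ 2 * d2 + 1 := by
  classical
  have h1 : (I.erase b).card ≤ 2 * d2 := by
    refine card_le_of_agree_off (I.erase b) x U hU (fun i hi j hj hij => ?_)
      fun i hi j hj => hoff i (Finset.mem_of_mem_erase hi) j (Finset.mem_of_mem_erase hj)
    have hi' : i ≠ b := Finset.ne_of_mem_erase hi
    have hj' : j ≠ b := Finset.ne_of_mem_erase hj
    exact h.le_dist hij (by tauto)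
  have := Finset.pred_card_le_card_erase (s := I) (a := b)
  omega

end Instance

/-! ### Random selection of coordinates -/

/-- Selects at most `u` elements of `{0, …, p - 1}`, according to the mixed radix digits of `r`. -/
def selSet : ℕ → ℕ → ℕ → Finset ℕ
  | 0, _, _ => ∅
  | p + 1, u, r =>
    if r % (p + 1) < u then insert p (selSet p (u - 1) (r / (p + 1)))
    else selSet p u (r / (p + 1))

theorem selSet_subset (p u r : ℕ) : selSet p u r ⊆ Finset.range p := by
  induction p generalizing u r with
  | zero => simp [selSet]
  | succ p ih =>
    have hs : Finset.range p ⊆ Finset.range (p + 1) := Finset.range_subset_range.2 (Nat.le_succ p)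
    rw [selSet]
    split_ifs
    · exact Finset.insert_subset (by simp) ((ih _ _).trans hs)
    · exact (ih _ _).trans hs

theorem card_selSet_le (p u r : ℕ) : (selSet p u r).card ≤ u := by
  induction p generalizing u r with
  | zero => simp [selSet]
  | succ p ih =>
    rw [selSet]
    split_ifs with h
    · refine (Finset.card_insert_le _ _).trans ?_
      have := ih (u - 1) (r / (p + 1))
      omega
    · exact ih _ _

/-- The selection reads only the digits of `r` to the radices `p, p - 1, …, 1`, and these have
period `p!`. -/
theorem selSet_mod_factorial (p u r : ℕ) : selSet p u (r % p.factorial) = selSet p u r := by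
  induction p generalizing u r with
  | zero => simp [selSet]
  | succ p ih =>
    rw [selSet, selSet, Nat.factorial_succ, Nat.mod_mul_right_mod, Nat.mod_mul_right_div_self,
      ih, ih]

/-- Splits off the lowest digit. It serves both the mixed radix of the selection and the base `2 ^
K` of the coin blocks. -/
theorem sum_range_mul_mod_div {M : Type*} [AddCommMonoid M] (a b : ℕ) (F : ℕ → ℕ → M) :
    ∑ r ∈ Finset.range (a * b), F (r % a) (r / a) =
      ∑ i ∈ Finset.range a, ∑ q ∈ Finset.range b, F i q := by
  rw [← Finset.sum_product']
  refine Finset.sum_nbij' (fun r => (r % a, r / a)) (fun z => z.1 + a * z.2) ?_ ?_ ?_ ?_ ?_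
  · intro r hr
    rw [Finset.mem_range] at hr
    have ha : 0 < a := Nat.pos_of_ne_zero fun h => by simp [h] at hr
    simp only [Finset.mem_product, Finset.mem_range]
    exact ⟨Nat.mod_lt _ ha, Nat.div_lt_of_lt_mul hr⟩
  · rintro ⟨i, q⟩ h
    simp only [Finset.mem_product, Finset.mem_range] at h ⊢
    calc i + a * q < a + a * q := by omega
      _ = a * (q + 1) := by ring
      _ ≤ a * b := Nat.mul_le_mul_left _ h.2
  · intro r _
    exact Nat.mod_add_div r a
  · rintro ⟨i, q⟩ h
    simp only [Finset.mem_product, Finset.mem_range] at h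
    rw [Prod.mk.injEq, Nat.add_mul_mod_self_left, Nat.mod_eq_of_lt h.1,
      Nat.add_mul_div_left _ _ (by omega), Nat.div_eq_of_lt h.1, zero_add]
    exact ⟨rfl, rfl⟩
  · intro r _
    rfl

/-- The number of `r < p!` for which the selection contains a given set `D`. -/
theorem card_subset_selSet (p u : ℕ) (hu : u ≤ p) (D : Finset ℕ) (hD : D ⊆ Finset.range p) :
    ((Finset.range p.factorial).filter fun r => D ⊆ selSet p u r).card =
      u.descFactorial D.card * (p - D.card).factorial := by
  induction p generalizing u D with
  | zero =>
    obtain rfl : D = ∅ := by simpa using hD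
    simp
  | succ p ih =>
    have hcard : D.card ≤ p + 1 := by simpa using Finset.card_le_card hD
    -- Condition on the lowest digit: the `u` values below `u` select `p` and leave `u - 1` elements
    -- to choose, while the other values leave `u`.
    have key : ((Finset.range (p + 1).factorial).filter fun r => D ⊆ selSet (p + 1) u r).card =
        ∑ i ∈ Finset.range (p + 1), (if i < u then
          ((Finset.range p.factorial).filter fun q => D.erase p ⊆ selSet p (u - 1) q).card
          else ((Finset.range p.factorial).filter fun q => D ⊆ selSet p u q).card) := by
      rw [Finset.card_filter, Nat.factorial_succ]
      refine Eq.trans ?_ ((sum_range_mul_mod_div (p + 1) p.factorial fun i q =>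
        if i < u then (if D.erase p ⊆ selSet p (u - 1) q then 1 else 0)
          else (if D ⊆ selSet p u q then 1 else 0)).trans ?_)
      · refine Finset.sum_congr rfl fun r _ => ?_
        rw [selSet]
        by_cases h : r % (p + 1) < u
        · simp only [h, if_true, Finset.subset_insert_iff]
        · simp only [h, if_false]
      · refine Finset.sum_congr rfl fun i _ => ?_
        split_ifs <;> rw [Finset.card_filter]
    have hfu : ((Finset.range (p + 1)).filter fun i => i < u).card = u := by
      have : ((Finset.range (p + 1)).filter fun i => i < u) = Finset.range u := by
        ext i; simp only [Finset.mem_filter, Finset.mem_range]; omega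
      rw [this, Finset.card_range]
    have hfu' : ((Finset.range (p + 1)).filter fun i => ¬ i < u).card = p + 1 - u := by
      have := Finset.card_filter_add_card_filter_not (s := Finset.range (p + 1)) fun i => i < u
      rw [hfu, Finset.card_range] at this
      omega
    rw [key, Finset.sum_ite, Finset.sum_const, Finset.sum_const, hfu, hfu', smul_eq_mul,
      smul_eq_mul]
    have hD' : D.erase p ⊆ Finset.range p := by
      intro i hi
      have h1 := Finset.mem_range.1 (hD (Finset.mem_of_mem_erase hi))
      have h2 := Finset.ne_of_mem_erase hi
      exact Finset.mem_range.2 (by omega)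
    rw [ih (u - 1) (by omega) _ hD']
    by_cases hp : p ∈ D
    · have h0 : ((Finset.range p.factorial).filter fun q => D ⊆ selSet p u q).card = 0 := by
        rw [Finset.card_eq_zero, Finset.filter_eq_empty_iff]
        intro q _ hq
        simpa using selSet_subset p u q (hq hp)
      have hpos : 0 < D.card := Finset.card_pos.2 ⟨p, hp⟩
      obtain ⟨d, hd⟩ : ∃ d, D.card = d + 1 := ⟨D.card - 1, by omega⟩
      rw [h0, Finset.card_erase_of_mem hp, hd, Nat.add_sub_cancel, Nat.add_sub_add_right, mul_zero,
        add_zero, ← mul_assoc]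
      congr 1
      cases u with
      | zero => simp
      | succ u => rw [Nat.succ_descFactorial_succ, Nat.add_sub_cancel]
    · rw [Finset.erase_eq_of_notMem hp] at hD' ⊢
      have hc : D.card ≤ p := by simpa using Finset.card_le_card hD'
      have h1 : (p + 1 - u) * ((Finset.range p.factorial).filter fun q => D ⊆ selSet p u q).card =
          (p + 1 - u) * (u.descFactorial D.card * (p - D.card).factorial) := by
        rcases Nat.lt_or_ge p u with h | h
        -- If `u = p + 1`, the induction hypothesis does not apply, but then no digit rejects `p`.
        · rw [show p + 1 - u = 0 by omega, zero_mul, zero_mul]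
        · rw [ih u h D hD']
      have h2 : u * (u - 1).descFactorial D.card = (u - D.card) * u.descFactorial D.card := by
        rw [← Nat.descFactorial_succ]
        cases u with
        | zero => simp
        | succ u => rw [Nat.succ_descFactorial_succ, Nat.add_sub_cancel]
      rw [h1, ← mul_assoc, h2, show p + 1 - D.card = (p - D.card) + 1 by omega, Nat.factorial_succ]
      -- For `u < D.card` the falling factorial vanishes; otherwise the truncated differences are
      -- genuine and `(u - D.card) + (p + 1 - u) = p + 1 - D.card`.
      rcases Nat.lt_or_ge u D.card with h | h
      · rw [Nat.descFactorial_of_lt h]; simp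
      · calc _ = ((u - D.card) + (p + 1 - u)) * (u.descFactorial D.card * (p - D.card).factorial) := by
              ring
          _ = (p - D.card + 1) * (u.descFactorial D.card * (p - D.card).factorial) := by
              congr 1; omega
          _ = _ := by ring

/-- The range below `B` contains `B / M` full periods of length `M`. -/
theorem div_mul_card_filter_le (M B : ℕ) (P : ℕ → Prop) [DecidablePred P] :
    B / M * ((Finset.range M).filter P).card ≤
      ((Finset.range B).filter fun r => P (r % M)).card := by
  calc B / M * ((Finset.range M).filter P).card
      = ((Finset.range (M * (B / M))).filter fun r => P (r % M)).card := by
        rw [Finset.card_filter, Finset.card_filter,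
          sum_range_mul_mod_div M (B / M) fun i _ => if P i then 1 else 0, Finset.mul_sum]
        simp
    _ ≤ _ := by
        refine Finset.card_le_card (Finset.filter_subset_filter _ ?_)
        exact Finset.range_subset_range.2 (Nat.mul_div_le B M)

/-- A uniformly random `r < B`, where `B ≥ m!`, selects a superset of `D` with probability at
least `(u)_d / (2 (m)_d)`. -/
theorem mul_descFactorial_le_card_subset_selSet {m u B : ℕ} (hu : u ≤ m) (hB : m.factorial ≤ B)
    (D : Finset ℕ) (hD : D ⊆ Finset.range m) :
    B * u.descFactorial D.card ≤ 2 * m.descFactorial D.card *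
      ((Finset.range B).filter fun r => D ⊆ selSet m u r).card := by
  have hd : D.card ≤ m := by simpa using Finset.card_le_card hD
  have h1 := div_mul_card_filter_le m.factorial B fun r => D ⊆ selSet m u r
  simp only [selSet_mod_factorial] at h1
  rw [card_subset_selSet m u hu D hD] at h1
  -- At least one full period fits below `B`, so the incomplete last period is less than half of the
  -- range. This is the factor `2` lost by reducing binary randomness modulo `m!`.
  have h2 : B ≤ 2 * (m.factorial * (B / m.factorial)) := by
    have h3 := Nat.div_add_mod B m.factorial
    have h4 := Nat.mod_lt B m.factorial_pos
    have h5 : m.factorial * 1 ≤ m.factorial * (B / m.factorial) :=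
      Nat.mul_le_mul_left _ (Nat.div_pos hB m.factorial_pos)
    omega
  have h6 := Nat.factorial_mul_descFactorial hd
  refine Nat.le_of_mul_le_mul_left ?_ (Nat.factorial_pos (m - D.card))
  calc (m - D.card).factorial * (B * u.descFactorial D.card)
      = B * (u.descFactorial D.card * (m - D.card).factorial) := by ring
    _ ≤ 2 * (m.factorial * (B / m.factorial)) *
        (u.descFactorial D.card * (m - D.card).factorial) := Nat.mul_le_mul_right _ h2
    _ = 2 * m.factorial * (B / m.factorial *
        (u.descFactorial D.card * (m - D.card).factorial)) := by ring
    _ ≤ 2 * m.factorial * _ := Nat.mul_le_mul_left _ h1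
    _ = _ := by rw [← h6]; ring

/-! ### Coin tosses -/

/-- The number with binary digits `ω c, …, ω (c + N - 1)`, most significant digit first. -/
def coinNum (ω : ℕ → Bool) (c : ℕ) : ℕ → ℕ
  | 0 => 0
  | N + 1 => 2 * coinNum ω c N + (ω (c + N)).toNat

theorem coinNum_lt (ω : ℕ → Bool) (c N : ℕ) : coinNum ω c N < 2 ^ N := by
  induction N with
  | zero => simp [coinNum]
  | succ N ih =>
    have := Bool.toNat_le (ω (c + N))
    rw [coinNum, pow_succ]
    omega

/-- Consecutive blocks of `N` coins become digits in base `2 ^ N`, with the latest block as the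
lowest digit. -/
theorem coinNum_add (ω : ℕ → Bool) (c N : ℕ) :
    coinNum ω 0 (c + N) = coinNum ω c N + 2 ^ N * coinNum ω 0 c := by
  induction N with
  | zero => simp [coinNum]
  | succ N ih =>
    rw [← add_assoc, coinNum, ih, coinNum, zero_add, pow_succ]
    ring

namespace RAM

instance : MeasureTheory.IsProbabilityMeasure coinLaw := by
  unfold coinLaw; infer_instance

/-- Fixing the number fixes each of the first `N` coins, so the event lies in a cylinder. Only this
upper bound is used later, which makes measurability of the events irrelevant. -/
theorem coinLaw_coinNum_eq (N v : ℕ) :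
    coinLaw {ω | coinNum ω 0 N = v} ≤ 2⁻¹ ^ N := by
  have key : ∀ v, ∃ b : ℕ → Bool, {ω : ℕ → Bool | coinNum ω 0 N = v} ⊆
      Set.pi (Finset.range N : Finset ℕ) fun i => {b i} := by
    induction N with
    | zero => intro v; exact ⟨fun _ => true, by simp⟩
    | succ N ih =>
      intro v
      obtain ⟨b, hb⟩ := ih (v / 2)
      refine ⟨Function.update b N (decide (v % 2 = 1)), ?_⟩
      intro ω hω i hi
      simp only [Set.mem_ofPred_eq, coinNum, zero_add] at hω
      have hle := Bool.toNat_le (ω N)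
      rcases eq_or_ne i N with rfl | hne
      · simp only [Function.update_self, Set.mem_singleton_iff]
        cases h : ω i <;> rw [h] at hω <;> simp at hω ⊢ <;> omega
      · simp only [Function.update_of_ne hne]
        have h1 : coinNum ω 0 N = v / 2 := by omega
        refine hb h1 i ?_
        simp only [Finset.coe_range, Set.mem_Iio] at hi ⊢
        omega
  obtain ⟨b, hb⟩ := key v
  refine (MeasureTheory.measure_mono hb).trans ?_
  rw [coinLaw, MeasureTheory.Measure.infinitePi_pi _ fun i _ => MeasurableSet.of_discrete]
  simp

theorem coinLaw_coinNum_mem (N : ℕ) (F : Finset ℕ) :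
    coinLaw.real {ω | coinNum ω 0 N ∈ F} ≤ F.card / 2 ^ N := by
  have h : {ω : ℕ → Bool | coinNum ω 0 N ∈ F} = ⋃ v ∈ F, {ω | coinNum ω 0 N = v} := by
    ext ω; simp
  rw [h]
  refine (MeasureTheory.measureReal_biUnion_finset_le _ _).trans ?_
  calc ∑ v ∈ F, coinLaw.real {ω | coinNum ω 0 N = v} ≤ ∑ _v ∈ F, ((2 : ℝ)⁻¹ ^ N) := by
        refine Finset.sum_le_sum fun v _ => ?_
        have := ENNReal.toReal_mono (by simp) (coinLaw_coinNum_eq N v)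
        simpa [MeasureTheory.measureReal_def] using this
    _ = _ := by simp [div_eq_mul_inv]

/-- The numbers below `B ^ R` all of whose `R` digits in base `B` avoid `G`. -/
def avoiding (B : ℕ) (G : Finset ℕ) : ℕ → Finset ℕ
  | 0 => {0}
  | R + 1 => (Finset.range (B * B ^ R)).filter fun v => v % B ∉ G ∧ v / B ∈ avoiding B G R

theorem avoiding_subset (B : ℕ) (G : Finset ℕ) (R : ℕ) :
    avoiding B G R ⊆ Finset.range (B ^ R) := by
  cases R with
  | zero => simp [avoiding]
  | succ R => rw [avoiding, pow_succ']; exact Finset.filter_subset _ _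

theorem card_avoiding (B : ℕ) (G : Finset ℕ) (hG : G ⊆ Finset.range B) (R : ℕ) :
    (avoiding B G R).card = (B - G.card) ^ R := by
  induction R with
  | zero => simp [avoiding]
  | succ R ih =>
    have h1 : ((Finset.range B).filter fun i => i ∉ G).card = B - G.card := by
      rw [Finset.filter_notMem_eq_sdiff, Finset.card_sdiff_of_subset hG, Finset.card_range]
    have h2 : (Finset.range (B ^ R)).filter (fun q => q ∈ avoiding B G R) = avoiding B G R := by
      rw [Finset.filter_mem_eq_inter, Finset.inter_eq_right]
      exact avoiding_subset B G R
    rw [avoiding, Finset.card_filter, sum_range_mul_mod_div B (B ^ R) fun i q =>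
      if i ∉ G ∧ q ∈ avoiding B G R then 1 else 0, pow_succ', ← ih, ← h1, Finset.card_filter,
      Finset.sum_mul]
    refine Finset.sum_congr rfl fun i _ => ?_
    by_cases hi : i ∈ G
    · simp [hi]
    · simp only [hi, not_false_eq_true, true_and, if_true, one_mul]
      rw [← Finset.card_filter, h2]

/-- Failure in every block is a statement about the digits of one number, so independence of the
blocks reduces to counting digit strings. -/
theorem coinNum_mem_avoiding (ω : ℕ → Bool) (K : ℕ) (G : Finset ℕ) (R : ℕ)
    (h : ∀ ρ < R, coinNum ω (ρ * K) K ∉ G) : coinNum ω 0 (R * K) ∈ avoiding (2 ^ K) G R := by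
  induction R with
  | zero => simp [avoiding, coinNum]
  | succ R ih =>
    have h1 := coinNum_add ω (R * K) K
    have h2 := coinNum_lt ω (R * K) K
    have h3 : coinNum ω 0 ((R + 1) * K) < 2 ^ K * (2 ^ K) ^ R := by
      have := coinNum_lt ω 0 ((R + 1) * K)
      rwa [mul_comm (R + 1) K, pow_mul, pow_succ', mul_comm K] at this
    rw [avoiding, Finset.mem_filter, Finset.mem_range]
    refine ⟨h3, ?_⟩
    rw [add_mul, one_mul, h1, Nat.add_mul_mod_self_left, Nat.mod_eq_of_lt h2,
      Nat.add_mul_div_left _ _ (by positivity), Nat.div_eq_of_lt h2, zero_add]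
    exact ⟨h R (Nat.lt_succ_self R), ih fun ρ hρ => h ρ (Nat.lt_succ_of_lt hρ)⟩

/-- Among `R` independent blocks of `K` coin tosses, at least one hits `G`. -/
theorem le_coinLaw_exists_block (K R : ℕ) (G : Finset ℕ) (hG : G ⊆ Finset.range (2 ^ K)) :
    1 - (1 - (G.card : ℝ) / 2 ^ K) ^ R ≤
      coinLaw.real {ω | ∃ ρ < R, coinNum ω (ρ * K) K ∈ G} := by
  set S : Set (ℕ → Bool) := {ω | ∃ ρ < R, coinNum ω (ρ * K) K ∈ G}
  have hle : G.card ≤ 2 ^ K := by simpa using Finset.card_le_card hG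
  have h1 : coinLaw.real Sᶜ ≤ (1 - (G.card : ℝ) / 2 ^ K) ^ R := by
    calc coinLaw.real Sᶜ ≤ coinLaw.real {ω | coinNum ω 0 (R * K) ∈ avoiding (2 ^ K) G R} := by
          refine MeasureTheory.measureReal_mono (fun ω hω => ?_)
          refine coinNum_mem_avoiding ω K G R fun ρ hρ hmem => hω ⟨ρ, hρ, hmem⟩
      _ ≤ (avoiding (2 ^ K) G R).card / 2 ^ (R * K) := coinLaw_coinNum_mem _ _
      _ = _ := by
          rw [card_avoiding _ _ hG, mul_comm R K, pow_mul, Nat.cast_pow, ← div_pow,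
            Nat.cast_sub hle, sub_div]
          simp
  -- Subadditivity on `S` and its complement holds without measurability of `S`.
  have h2 : 1 ≤ coinLaw.real S + coinLaw.real Sᶜ := by
    have := MeasureTheory.measureReal_union_le (μ := coinLaw) S Sᶜ
    rwa [Set.union_compl_self, MeasureTheory.probReal_univ] at this
  linarith

end RAM

/-! ### Reasoning about programs with time bounds -/

namespace RAM

theorem setReg_reg (s : State) (r v q : ℕ) :
    (s.setReg r v).reg q = if q = r then v else s.reg q :=
  Function.update_apply _ _ _ _

theorem setReg_mem (s : State) (r v : ℕ) : (s.setReg r v).mem = s.mem := rfl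

theorem setReg_coins (s : State) (r v : ℕ) : (s.setReg r v).coins = s.coins := rfl

theorem setMem_reg (s : State) (i v : ℕ) : (s.setMem i v).reg = s.reg := rfl

theorem setMem_mem (s : State) (i v j : ℕ) :
    (s.setMem i v).mem j = if j = i then v else s.mem j :=
  Function.update_apply _ _ _ _

theorem setMem_coins (s : State) (i v : ℕ) : (s.setMem i v).coins = s.coins := rfl

/-- The number of nodes of an expression. -/
def Expr.nodes : Expr → ℕ
  | .lit _ => 1
  | .reg _ => 1
  | .load e => e.nodes + 1
  | .bin _ e f => e.nodes + f.nodes + 1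

/-- The result of the operation has at most `S` bits, if the operands have. -/
def Op.Fits (S : ℕ) : Op → ℕ → ℕ → Prop
  | .add, u, v => u + v < 2 ^ S
  | .sub, _, _ => True
  | .mul, u, v => u * v < 2 ^ S
  | .div, _, _ => True
  | .mod, _, _ => True

/-- All numbers that occur in the evaluation of the expression have at most `S` bits. -/
def Expr.Fits (s : State) (S : ℕ) : Expr → Prop
  | .lit k => k < 2 ^ S
  | .reg r => s.reg r < 2 ^ S
  | .load e => e.Fits s S ∧ s.mem (e.eval s) < 2 ^ S
  | .bin op e f => e.Fits s S ∧ f.Fits s S ∧ op.Fits S (e.eval s) (f.eval s)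

theorem Op.Fits.eval_lt {S u v : ℕ} {op : Op} (h : op.Fits S u v) (hu : u < 2 ^ S) :
    op.eval u v < 2 ^ S := by
  cases op with
  | add => exact h
  | sub => exact (Nat.sub_le u v).trans_lt hu
  | mul => exact h
  | div => exact (Nat.div_le_self u v).trans_lt hu
  | mod => exact (Nat.mod_le u v).trans_lt hu

theorem Expr.Fits.eval_lt {s : State} {S : ℕ} {e : Expr} (h : e.Fits s S) : e.eval s < 2 ^ S := by
  induction e with
  | lit k => exact h
  | reg r => exact h
  | load e _ => exact h.2
  | bin op e f ihe _ => exact h.2.2.eval_lt (ihe h.1)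

theorem Expr.Fits.size_le {s : State} {S : ℕ} {e : Expr} (h : e.Fits s S) :
    (e.eval s).size ≤ S :=
  Nat.size_le.2 h.eval_lt

theorem Op.cost_le {S u v : ℕ} (op : Op) (hu : u.size ≤ S) (hv : v.size ≤ S) :
    op.cost u v ≤ (S + 1) ^ 2 := by
  have h1 : 1 + u.size + v.size ≤ (S + 1) ^ 2 := by nlinarith
  have h2 : (1 + u.size) * (1 + v.size) ≤ (S + 1) ^ 2 := by
    rw [sq]; exact Nat.mul_le_mul (by omega) (by omega)
  cases op <;> assumption

/-- Each node is charged at most `2 (S + 1) ^ 2`; a node `load` handles both an address and a value.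
-/
theorem Expr.Fits.cost_le {s : State} {S : ℕ} {e : Expr} (h : e.Fits s S) :
    e.cost s ≤ 2 * e.nodes * (S + 1) ^ 2 := by
  have hS : S + 1 ≤ (S + 1) ^ 2 := Nat.le_self_pow two_ne_zero _
  induction e with
  | lit k =>
    have h1 : k.size ≤ S := Nat.size_le.2 h
    simp only [Expr.cost, Expr.nodes]
    omega
  | reg r =>
    have h1 : (s.reg r).size ≤ S := Nat.size_le.2 h
    simp only [Expr.cost, Expr.nodes]
    omega
  | load e ih =>
    have h1 : (e.eval s).size ≤ S := h.1.size_le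
    have h2 : (s.mem (e.eval s)).size ≤ S := Nat.size_le.2 h.2
    have h3 := ih h.1
    simp only [Expr.cost, Expr.nodes, mul_add, add_mul]
    omega
  | bin op e f ihe ihf =>
    have h1 := ihe h.1
    have h2 := ihf h.2.1
    have h3 := op.cost_le h.1.size_le h.2.1.size_le
    simp only [Expr.cost, Expr.nodes, mul_add, add_mul]
    omega

/-- A bound for the time of an elementary step on numbers of at most `S` bits. -/
def stepTime (S : ℕ) : ℕ := 200 * (S + 1) ^ 2

/-- All expressions of the program have at most `40` nodes. A store evaluates two of them, and `2 *
81 ≤ 200` explains the constant in `stepTime`. -/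
theorem Expr.Fits.cost_add_le {s : State} {S : ℕ} {e : Expr} (h : e.Fits s S)
    (hn : e.nodes ≤ 40) : e.cost s + 1 + S ≤ 81 * (S + 1) ^ 2 := by
  have h1 := h.cost_le
  have h2 : 2 * e.nodes * (S + 1) ^ 2 ≤ 80 * (S + 1) ^ 2 := Nat.mul_le_mul_right _ (by omega)
  have hS : S + 1 ≤ (S + 1) ^ 2 := Nat.le_self_pow two_ne_zero _
  omega

theorem Expr.Fits.cost_add_one_le {s : State} {S : ℕ} {e : Expr} (h : e.Fits s S)
    (hn : e.nodes ≤ 40) : e.cost s + 1 ≤ stepTime S := by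
  have := h.cost_add_le hn
  rw [stepTime]
  omega

/-- Started in the state `s`, the program halts within time `T`, in a state that satisfies `Q`. -/
def Runs {m : ℕ} (dec : Cube m → Cube m) (ω : ℕ → Bool) (c : Cmd) (s : State) (T : ℕ)
    (Q : State → Prop) : Prop :=
  ∃ s' t, Exec dec ω c s s' t ∧ t ≤ T ∧ Q s'

section Rules

variable {m : ℕ} {dec : Cube m → Cube m} {ω : ℕ → Bool} {s : State} {S T T' : ℕ}
  {c c' : Cmd} {e f : Expr} {Q Q' : State → Prop}

theorem Runs.mono (h : Runs dec ω c s T Q) (hT : T ≤ T') (hQ : ∀ s', Q s' → Q' s') :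
    Runs dec ω c s T' Q' := by
  obtain ⟨s', t, hx, ht, hq⟩ := h
  exact ⟨s', t, hx, ht.trans hT, hQ s' hq⟩

theorem Runs.skip (h : Q s) : Runs dec ω .skip s (stepTime S) Q :=
  ⟨s, 1, .skip s, Nat.mul_pos (by norm_num) (by positivity), h⟩

theorem Runs.assign {r : ℕ} (hf : e.Fits s S) (hn : e.nodes ≤ 40)
    (h : Q (s.setReg r (e.eval s))) : Runs dec ω (.assign r e) s (stepTime S) Q := by
  refine ⟨_, _, .assign r e s, ?_, h⟩
  have h1 := hf.cost_add_le hn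
  have h2 := hf.size_le
  rw [stepTime]
  omega

theorem Runs.store (hff : f.Fits s S) (hfn : f.nodes ≤ 40) (hf : e.Fits s S) (hn : e.nodes ≤ 40)
    (h : Q (s.setMem (f.eval s) (e.eval s))) : Runs dec ω (.store f e) s (stepTime S) Q := by
  refine ⟨_, _, .store f e s, ?_, h⟩
  have h1 := hf.cost_add_le hn
  have h2 := hf.size_le
  have h3 := hff.cost_add_le hfn
  have h4 := hff.size_le
  rw [stepTime]
  omega

theorem Runs.flip {r : ℕ} (h : Q { s.setReg r (ω s.coins).toNat with coins := s.coins + 1 }) :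
    Runs dec ω (.flip r) s (stepTime S) Q := by
  refine ⟨_, _, .flip r s, ?_, h⟩
  have : 1 ≤ (S + 1) ^ 2 := Nat.one_le_pow _ _ (by omega)
  rw [stepTime]
  omega

theorem Runs.seq (h : Runs dec ω c s T Q) (h' : ∀ s', Q s' → Runs dec ω c' s' T' Q') :
    Runs dec ω (.seq c c') s (T + T') Q' := by
  obtain ⟨s', t, hx, ht, hq⟩ := h
  obtain ⟨s'', t', hx', ht', hq'⟩ := h' s' hq
  exact ⟨s'', _, .seq c c' s s' s'' t t' hx hx', by omega, hq'⟩

theorem Runs.assign_seq {r : ℕ} (hf : e.Fits s S) (hn : e.nodes ≤ 40)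
    (h : Runs dec ω c (s.setReg r (e.eval s)) T Q) :
    Runs dec ω (.seq (.assign r e) c) s (stepTime S + T) Q :=
  Runs.seq (Q := fun s' => s' = s.setReg r (e.eval s)) (Runs.assign hf hn rfl)
    fun _ hs => hs ▸ h

theorem Runs.ite (hf : e.Fits s S) (hn : e.nodes ≤ 40)
    (h1 : e.eval s ≠ 0 → Runs dec ω c s T Q) (h2 : e.eval s = 0 → Runs dec ω c' s T Q) :
    Runs dec ω (.ite e c c') s (stepTime S + T) Q := by
  have h3 := hf.cost_add_one_le hn
  by_cases h : e.eval s = 0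
  · obtain ⟨s', t, hx, ht, hq⟩ := h2 h
    exact ⟨s', _, .iteFalse e c c' s s' t h hx, by omega, hq⟩
  · obtain ⟨s', t, hx, ht, hq⟩ := h1 h
    exact ⟨s', _, .iteTrue e c c' s s' t h hx, by omega, hq⟩

/-- A loop that is passed `N` times, with an invariant `I`. -/
theorem Runs.loop (I : ℕ → State → Prop) (N : ℕ) (hn : e.nodes ≤ 40)
    (hstep : ∀ i < N, ∀ s, I i s → e.Fits s S ∧ e.eval s ≠ 0 ∧ Runs dec ω c s T (I (i + 1)))
    (hend : ∀ s, I N s → e.Fits s S ∧ e.eval s = 0) (h0 : I 0 s) :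
    Runs dec ω (.loop e c) s (N * (stepTime S + T) + stepTime S) (I N) := by
  have key : ∀ k i s, i + k = N → I i s →
      Runs dec ω (.loop e c) s (k * (stepTime S + T) + stepTime S) (I N) := by
    intro k
    induction k with
    | zero =>
      intro i s hi hs
      obtain rfl : i = N := by omega
      obtain ⟨hf, hz⟩ := hend s hs
      exact ⟨s, _, .loopDone e c s hz, by have := hf.cost_add_one_le hn; omega, hs⟩
    | succ k ih =>
      intro i s hi hs
      obtain ⟨hf, hz, s', t, hx, ht, hq⟩ := hstep i (by omega) s hs
      obtain ⟨s'', t', hx', ht', hq'⟩ := ih (i + 1) s' (by omega) hq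
      refine ⟨s'', _, .loopStep e c s s' s'' t t' hz hx hx', ?_, hq'⟩
      have := hf.cost_add_one_le hn
      rw [add_mul, one_mul]
      omega
  exact key N 0 s (by omega) h0

end Rules

end RAM

/-! ### The program

Each repetition selects at random fewer than `2 d2` coordinates and sorts the vectors into buckets
according to the other coordinates.  By the Plotkin bound a bucket has at most `2 d2 + 1` entries,
so that all pairs in a bucket can be compared.  The closest pair is found as soon as the selection
contains all coordinates in which its two vectors differ.  No decoder is used. -/

namespace RAM.ClosestPair

open RAM.Expr RAM.Cmd

local infixl:65 "+ₑ" => Expr.bin Op.add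
local infixl:65 "-ₑ" => Expr.bin Op.sub
local infixl:70 "*ₑ" => Expr.bin Op.mul
local infixl:70 "/ₑ" => Expr.bin Op.div
local infixl:70 "%ₑ" => Expr.bin Op.mod
local infixr:60 ";;" => Cmd.seq

/-- Add to register `17` the difference of the vectors with numbers in the registers `10`
and `16` at the coordinate in register `12`. -/
def distBody : Cmd :=
  assign 17 (reg 17 +ₑ
    ((load (reg 10 *ₑ reg 1 +ₑ reg 12) -ₑ load (reg 16 *ₑ reg 1 +ₑ reg 12)) +ₑ
      (load (reg 16 *ₑ reg 1 +ₑ reg 12) -ₑ load (reg 10 *ₑ reg 1 +ₑ reg 12)))) ;;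
  assign 12 (reg 12 +ₑ lit 1)

def distLoop : Cmd := loop (reg 1 -ₑ reg 12) distBody

/-- Compare the current vector with the entry number `reg 15` of the bucket `reg 11`. -/
def probeBody : Cmd :=
  assign 16 (load (reg 11 *ₑ (reg 0 +ₑ lit 1) +ₑ reg 15) -ₑ lit 1) ;;
  assign 17 (lit 0) ;; assign 12 (lit 0) ;; distLoop ;;
  -- With truncated subtraction the test is nonzero exactly when the distance is at most `dmin`.
  ite (lit 1 -ₑ (reg 17 -ₑ reg 2)) (assign 6 (reg 10) ;; assign 7 (reg 16)) skip ;;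
  assign 15 (reg 15 +ₑ lit 1)

/-- Buckets are terminated by a zero cell, which is why vector numbers are stored increased by `1`.
-/
def probeLoop : Cmd := loop (load (reg 11 *ₑ (reg 0 +ₑ lit 1) +ₑ reg 15)) probeBody

/-- Process the coordinate `reg 12 - 1` in the computation of the key of the current vector. -/
def keyBody : Cmd :=
  -- The test succeeds when the current digit of the random number is smaller than the number of
  -- coordinates still to be selected, as in `selSet`. A selected coordinate contributes the digit
  -- `0` to the key.
  ite (reg 14 -ₑ (reg 13 %ₑ reg 12))
    (assign 14 (reg 14 -ₑ lit 1) ;; assign 11 (lit 2 *ₑ reg 11))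
    (assign 11 (lit 2 *ₑ reg 11 +ₑ load (reg 10 *ₑ reg 1 +ₑ (reg 12 -ₑ lit 1)))) ;;
  assign 13 (reg 13 /ₑ reg 12) ;; assign 12 (reg 12 -ₑ lit 1)

def keyLoop : Cmd := loop (reg 12) keyBody

/-- Compute the key of the vector `reg 10`, compare the vector with the entries of
its bucket, and append it to the bucket. -/
def vecBody : Cmd :=
  assign 11 (reg 5) ;; assign 12 (reg 1) ;; assign 13 (reg 8) ;; assign 14 (reg 4) ;; keyLoop ;;
  assign 15 (lit 0) ;; probeLoop ;;
  store (reg 11 *ₑ (reg 0 +ₑ lit 1) +ₑ reg 15) (reg 10 +ₑ lit 1) ;;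
  assign 10 (reg 10 +ₑ lit 1)

def vecLoop : Cmd := loop (reg 0 -ₑ reg 10) vecBody

def coinBody : Cmd :=
  flip 10 ;; assign 8 (lit 2 *ₑ reg 8 +ₑ reg 10) ;; assign 9 (reg 9 +ₑ lit 1)

def coinLoop : Cmd := loop (reg 1 *ₑ reg 1 -ₑ reg 9) coinBody

/-- One repetition: choose a random set of coordinates and sort the vectors into buckets
according to the other coordinates. -/
def repBody : Cmd :=
  assign 8 (lit 0) ;; assign 9 (lit 0) ;; coinLoop ;; assign 10 (lit 0) ;; vecLoop ;;
  assign 5 (reg 5 -ₑ lit 1)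

/-- Register `5` counts the remaining repetitions and is also the leading part of every key. Each
repetition therefore uses fresh memory, and nothing has to be erased. -/
def repLoop : Cmd := loop (reg 5) repBody

/-- The two products grow into the falling factorials of `m` and of the selection size, whose
quotient governs the number of repetitions. -/
def ratioBody : Cmd :=
  assign 8 (reg 8 *ₑ (reg 1 -ₑ reg 10)) ;; assign 9 (reg 9 *ₑ (reg 4 -ₑ reg 10)) ;;
  assign 10 (reg 10 +ₑ lit 1)

def ratioLoop : Cmd := loop (reg 2 -ₑ reg 10) ratioBody

/-- Compute the number of selected coordinates and the number of repetitions. -/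
def setup : Cmd :=
  assign 4 (lit 2 *ₑ reg 3 -ₑ lit 1) ;; ite (reg 4 -ₑ reg 1) (assign 4 (reg 1)) skip ;;
  assign 8 (lit 1) ;; assign 9 (lit 1) ;; assign 10 (lit 0) ;; ratioLoop ;;
  assign 5 ((reg 8 /ₑ reg 9 +ₑ lit 1) *ₑ (lit 4 *ₑ (reg 1 +ₑ lit 1)))

/-- Find the closest pair. -/
def program : Cmd := setup ;; repLoop ;; assign 0 (reg 6) ;; assign 1 (reg 7)

theorem program_oracleFree : program.OracleFree := by
  simp [program, setup, repLoop, repBody, ratioLoop, ratioBody, coinLoop, coinBody, vecLoop,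
    vecBody, keyLoop, keyBody, probeLoop, probeBody, distLoop, distBody, Cmd.OracleFree]

set_option linter.unusedSimpArgs false

/-! ### Distances, keys, and the scan of one bucket -/

section Loops

variable {m : ℕ} {dec : Cube m → Cube m} {ω : ℕ → Bool} {s : State} {S : ℕ}

theorem distLoop_runs {i j M : ℕ} {f g : ℕ → ℕ} (h1 : s.reg 1 = M) (h10 : s.reg 10 = i)
    (h16 : s.reg 16 = j) (h12 : s.reg 12 = 0) (h17 : s.reg 17 = 0)
    (hf : ∀ p < M, s.mem (i * M + p) = f p) (hg : ∀ p < M, s.mem (j * M + p) = g p)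
    (hf1 : ∀ p, f p ≤ 1) (hg1 : ∀ p, g p ≤ 1)
    (hi : i < 2 ^ S) (hj : j < 2 ^ S) (hiM : i * M + M < 2 ^ S) (hjM : j * M + M < 2 ^ S)
    (h2 : 2 < 2 ^ S) :
    Runs dec ω distLoop s ((3 * M + 1) * stepTime S) fun s' =>
      s'.reg 17 = ∑ p ∈ Finset.range M, ((f p - g p) + (g p - f p)) ∧
      (∀ q, q ≠ 12 → q ≠ 17 → s'.reg q = s.reg q) ∧ s'.mem = s.mem ∧ s'.coins = s.coins := by
  have hsum : ∀ k, ∑ p ∈ Finset.range k, ((f p - g p) + (g p - f p)) ≤ k := by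
    intro k
    refine (Finset.sum_le_card_nsmul _ _ 1 fun p _ => ?_).trans (by simp)
    have := hf1 p; have := hg1 p; omega
  refine (Runs.loop (T := stepTime S + stepTime S) (fun k s' => s'.reg 12 = k ∧
    s'.reg 17 = ∑ p ∈ Finset.range k, ((f p - g p) + (g p - f p)) ∧
    (∀ q, q ≠ 12 → q ≠ 17 → s'.reg q = s.reg q) ∧ s'.mem = s.mem ∧ s'.coins = s.coins)
    M (by decide) ?_ ?_ ?_).mono (le_of_eq (by ring)) ?_
  · rintro k hk s' ⟨e12, e17, efr, emem, eco⟩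
    have e1 : s'.reg 1 = M := by rw [efr 1 (by decide) (by decide), h1]
    have e10 : s'.reg 10 = i := by rw [efr 10 (by decide) (by decide), h10]
    have e16 : s'.reg 16 = j := by rw [efr 16 (by decide) (by decide), h16]
    have hs := hsum k
    have := hf1 k; have := hg1 k
    refine ⟨?_, ?_, Runs.assign_seq ?_ (by decide) (Runs.assign ?_ (by decide) ?_)⟩
    · simp only [and_true, true_and, Expr.Fits, Op.Fits, e1, e12]; omega
    · simp only [Expr.eval, Op.eval, e1, e12]; omega
    · simp only [and_true, true_and, Expr.Fits, Op.Fits, Expr.eval, Op.eval, e1, e12, e10, e16, e17, emem, hf k hk,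
        hg k hk]
      omega
    · simp only [and_true, true_and, Expr.Fits, Op.Fits, Expr.eval, Op.eval, Nat.reduceEqDiff, reduceIte, setReg_reg, e12]
      omega
    · simp only [Expr.eval, Op.eval, Nat.reduceEqDiff, reduceIte, setReg_reg, setReg_mem, setReg_coins, e1, e12, e10, e16, e17,
        emem, hf k hk, hg k hk, eco, Finset.sum_range_succ]
      refine ⟨by simp, by simp, fun q hq hq' => ?_, trivial, trivial⟩
      simp [hq, hq', efr q hq hq']
  · rintro s' ⟨e12, e17, efr, emem, eco⟩
    have e1 : s'.reg 1 = M := by rw [efr 1 (by decide) (by decide), h1]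
    simp only [and_true, true_and, Expr.Fits, Op.Fits, Expr.eval, Op.eval, e1, e12]
    omega
  · exact ⟨h12, by simpa using h17, fun _ _ _ => rfl, rfl, rfl⟩
  · rintro s' ⟨-, e17, efr⟩
    exact ⟨e17, efr⟩

/-- The key of a vector with entries `f`: its entries outside the selection. -/
def keyNum (f : ℕ → ℕ) : ℕ → ℕ → ℕ → ℕ → ℕ
  | 0, _, _, k => k
  | p + 1, u, r, k =>
    if r % (p + 1) < u then keyNum f p (u - 1) (r / (p + 1)) (2 * k)
    else keyNum f p u (r / (p + 1)) (2 * k + f p)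

/-- Together with `keyNum_lt` this places the keys with start value `k` in `[k * 2 ^ p, (k + 1) * 2
^ p)`, so that different repetitions use disjoint intervals of keys. -/
theorem le_keyNum (f : ℕ → ℕ) (p u r k : ℕ) : k * 2 ^ p ≤ keyNum f p u r k := by
  induction p generalizing u r k with
  | zero => simp [keyNum]
  | succ p ih =>
    rw [keyNum, pow_succ']
    split_ifs
    · exact (le_of_eq (by ring)).trans (ih _ _ _)
    · refine le_trans ?_ (ih _ _ _)
      rw [add_mul]
      exact (le_of_eq (by ring)).trans (Nat.le_add_right _ _)

theorem keyNum_lt {f : ℕ → ℕ} (hf : ∀ p, f p ≤ 1) (p u r k : ℕ) :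
    keyNum f p u r k < (k + 1) * 2 ^ p := by
  induction p generalizing u r k with
  | zero => simp [keyNum]
  | succ p ih =>
    have h2 : (k + 1) * 2 ^ (p + 1) = (2 * k + 2) * 2 ^ p := by ring
    rw [keyNum, h2]
    have := hf p
    split_ifs
    · exact (ih _ _ _).trans_le (Nat.mul_le_mul_right _ (by omega))
    · exact (ih _ _ _).trans_le (Nat.mul_le_mul_right _ (by omega))

/-- Each step appends one binary digit, so equal keys force equal digits; at selected positions both
digits are `0`. -/
theorem keyNum_eq_iff {f g : ℕ → ℕ} (hf : ∀ p, f p ≤ 1) (hg : ∀ p, g p ≤ 1) (p u r k k' : ℕ) :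
    keyNum f p u r k = keyNum g p u r k' ↔
      k = k' ∧ ∀ q < p, q ∉ selSet p u r → f q = g q := by
  induction p generalizing u r k k' with
  | zero => simp [keyNum]
  | succ p ih =>
    rw [keyNum, keyNum, selSet]
    have := hf p; have := hg p
    split_ifs with h
    · rw [ih]
      refine ⟨fun ⟨h1, h2⟩ => ⟨by omega, fun q hq hs => ?_⟩, fun ⟨h1, h2⟩ => ⟨by omega, fun q hq hs => ?_⟩⟩
      · rw [Finset.mem_insert, not_or] at hs
        exact h2 q (by omega) hs.2
      · refine h2 q (by omega) ?_
        rw [Finset.mem_insert, not_or]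
        exact ⟨by omega, hs⟩
    · rw [ih]
      refine ⟨fun ⟨h1, h2⟩ => ⟨by omega, fun q hq hs => ?_⟩, fun ⟨h1, h2⟩ => ⟨?_, fun q hq hs => ?_⟩⟩
      · rcases eq_or_ne q p with rfl | hne
        · omega
        · exact h2 q (by omega) hs
      · rw [h1, h2 p (by omega) fun hp => ?_]
        simpa using selSet_subset _ _ _ hp
      · exact h2 q (by omega) hs

theorem keyLoop_runs {i M k r u : ℕ} {f : ℕ → ℕ} (h1 : s.reg 1 = M) (h10 : s.reg 10 = i)
    (h11 : s.reg 11 = k) (h12 : s.reg 12 = M) (h13 : s.reg 13 = r) (h14 : s.reg 14 = u)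
    (hf : ∀ p < M, s.mem (i * M + p) = f p)
    (hi : i < 2 ^ S) (hiM : i * M + M < 2 ^ S) (hr : r < 2 ^ S) (hu : u < 2 ^ S)
    (hk : keyNum f M u r k < 2 ^ S) (h2 : 2 < 2 ^ S) :
    Runs dec ω keyLoop s ((6 * M + 1) * stepTime S) fun s' =>
      s'.reg 11 = keyNum f M u r k ∧
      (∀ q, q ≠ 11 → q ≠ 12 → q ≠ 13 → q ≠ 14 → s'.reg q = s.reg q) ∧
      s'.mem = s.mem ∧ s'.coins = s.coins := by
  -- Partial keys never exceed the final one, so they fit into `S` bits as well.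
  have hle : ∀ p u r k, k ≤ keyNum f p u r k := fun p u r k =>
    (Nat.le_mul_of_pos_right k (by positivity)).trans (le_keyNum f p u r k)
  -- Invariant: completing the key from the current registers gives the key wanted at the start.
  refine (Runs.loop (T := (stepTime S + (stepTime S + stepTime S)) + (stepTime S + stepTime S))
    (fun t s' => s'.reg 12 = M - t ∧
    keyNum f (M - t) (s'.reg 14) (s'.reg 13) (s'.reg 11) = keyNum f M u r k ∧
    s'.reg 13 ≤ r ∧ s'.reg 14 ≤ u ∧
    (∀ q, q ≠ 11 → q ≠ 12 → q ≠ 13 → q ≠ 14 → s'.reg q = s.reg q) ∧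
    s'.mem = s.mem ∧ s'.coins = s.coins) M (by decide) ?_ ?_ ?_).mono (le_of_eq (by ring)) ?_
  · rintro t ht s' ⟨e12, ekey, e13, e14, efr, emem, eco⟩
    obtain ⟨p, hp⟩ : ∃ p, M - t = p + 1 := ⟨M - t - 1, by omega⟩
    have hp' : M - (t + 1) = p := by omega
    have e1 : s'.reg 1 = M := by rw [efr 1 (by decide) (by decide) (by decide) (by decide), h1]
    have e10 : s'.reg 10 = i := by
      rw [efr 10 (by decide) (by decide) (by decide) (by decide), h10]
    have hfp := hf p (by omega)
    rw [hp] at e12 ekey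
    rw [hp']
    refine ⟨?_, ?_, Runs.seq (Q := fun s₁ => s₁.reg 12 = p + 1 ∧ s₁.reg 13 = s'.reg 13 ∧
      keyNum f p (s₁.reg 14) (s₁.reg 13 / (p + 1)) (s₁.reg 11) = keyNum f M u r k ∧
      s₁.reg 14 ≤ u ∧
      (∀ q, q ≠ 11 → q ≠ 12 → q ≠ 13 → q ≠ 14 → s₁.reg q = s.reg q) ∧
      s₁.mem = s.mem ∧ s₁.coins = s.coins) (Runs.ite ?_ (by decide) ?_ ?_) ?_⟩
    · simp only [Expr.Fits, e12]; omega
    · simp only [Expr.eval, e12]; omega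
    · simp only [and_true, true_and, Expr.Fits, Op.Fits, e12]; omega
    · intro hlt
      simp only [Expr.eval, Op.eval, e12] at hlt
      rw [keyNum, if_pos (by omega)] at ekey
      have := hle p (s'.reg 14 - 1) (s'.reg 13 / (p + 1)) (2 * s'.reg 11)
      refine Runs.assign_seq ?_ (by decide) (Runs.assign ?_ (by decide) ?_)
      · simp only [and_true, true_and, Expr.Fits, Op.Fits]; omega
      · simp only [and_true, true_and, Expr.Fits, Op.Fits, Expr.eval, Op.eval, Nat.reduceEqDiff,
          reduceIte, setReg_reg]
        omega
      · simp only [Expr.eval, Op.eval, Nat.reduceEqDiff, reduceIte, setReg_reg, setReg_mem,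
          setReg_coins]
        refine ⟨e12, trivial, ekey, by omega, fun q q1 q2 q3 q4 => ?_, emem, eco⟩
        simp only [q1, q4, if_false, efr q q1 q2 q3 q4]
    · intro hge
      simp only [Expr.eval, Op.eval, e12] at hge
      rw [keyNum, if_neg (by omega)] at ekey
      have := hle p (s'.reg 14) (s'.reg 13 / (p + 1)) (2 * s'.reg 11 + f p)
      refine (Runs.assign (S := S) ?_ (by decide) ?_).mono (Nat.le_add_left _ _) fun _ h => h
      · simp only [and_true, true_and, Expr.Fits, Op.Fits, Expr.eval, Op.eval, e12, e10, e1, emem,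
          Nat.add_sub_cancel, hfp]
        omega
      · simp only [Expr.eval, Op.eval, Nat.reduceEqDiff, reduceIte, setReg_reg, setReg_mem,
          setReg_coins, e12, e10, e1, emem, Nat.add_sub_cancel, hfp]
        refine ⟨trivial, trivial, ekey, by omega, fun q q1 q2 q3 q4 => ?_, trivial, eco⟩
        simp only [q1, if_false, efr q q1 q2 q3 q4]
    · rintro s₁ ⟨a12, a13, akey, a14, afr, amem, aco⟩
      have hdiv : s₁.reg 13 / (p + 1) ≤ r := (Nat.div_le_self _ _).trans (by omega)
      refine Runs.assign_seq ?_ (by decide) (Runs.assign ?_ (by decide) ?_)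
      · simp only [and_true, true_and, Expr.Fits, Op.Fits]; omega
      · simp only [and_true, true_and, Expr.Fits, Op.Fits, Nat.reduceEqDiff, reduceIte, setReg_reg]
        omega
      · simp only [Expr.eval, Op.eval, Nat.reduceEqDiff, reduceIte, setReg_reg, setReg_mem,
          setReg_coins, a12, Nat.add_sub_cancel]
        refine ⟨trivial, akey, hdiv, a14, fun q q1 q2 q3 q4 => ?_, amem, aco⟩
        simp only [q2, q3, if_false, afr q q1 q2 q3 q4]
  · rintro s' ⟨e12, -⟩
    simp only [Expr.Fits, Expr.eval, e12]
    omega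
  · refine ⟨h12, ?_, h13.le, h14.le, fun _ _ _ _ _ => rfl, rfl, rfl⟩
    rw [h14, h13, h11, Nat.sub_zero]
  · rintro s' ⟨-, ekey, -, -, efr⟩
    rw [Nat.sub_self, keyNum] at ekey
    exact ⟨ekey, efr⟩

/-- The Hamming distance of two vectors with entries in `{0, 1}`. -/
def natDist (M : ℕ) (f g : ℕ → ℕ) : ℕ := ∑ p ∈ Finset.range M, ((f p - g p) + (g p - f p))

theorem natDist_le {f g : ℕ → ℕ} (hf : ∀ p, f p ≤ 1) (hg : ∀ p, g p ≤ 1) (M : ℕ) :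
    natDist M f g ≤ M := by
  refine (Finset.sum_le_card_nsmul _ _ 1 fun p _ => ?_).trans (by simp)
  have := hf p; have := hg p; omega

/-- `F` will mean being the closest pair. A stored pair is overwritten only by a pair at distance at
most `dmin`, for which `F` holds by `hF`; hence a correct answer is never lost. -/
theorem probeLoop_runs {n M dmin i κ N : ℕ} {x : ℕ → ℕ → ℕ} {l : ℕ → ℕ} {F : ℕ → ℕ → Prop}
    (h0 : s.reg 0 = n) (h1 : s.reg 1 = M) (h2 : s.reg 2 = dmin) (h10 : s.reg 10 = i)
    (h11 : s.reg 11 = κ) (h15 : s.reg 15 = 0) (h6 : s.reg 6 ≤ n) (h7 : s.reg 7 ≤ n)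
    (hx : ∀ j < n, ∀ p < M, s.mem (j * M + p) = x j p) (hx1 : ∀ j p, x j p ≤ 1)
    (hi : i < n) (hl : ∀ t < N, s.mem (κ * (n + 1) + t) = l t + 1) (hln : ∀ t < N, l t < n)
    (hlN : s.mem (κ * (n + 1) + N) = 0) (hN : N ≤ n)
    (hF : ∀ t < N, natDist M (x i) (x (l t)) ≤ dmin → F i (l t))
    (hκ : κ * (n + 1) + n < 2 ^ S) (hκ' : κ < 2 ^ S) (hn : n + 1 < 2 ^ S)
    (hnM : n * M + M < 2 ^ S) (hd : dmin < 2 ^ S) (hS : 2 < 2 ^ S) :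
    Runs dec ω probeLoop s ((N * (3 * M + 9) + 1) * stepTime S) fun s' =>
      s'.reg 15 = N ∧ s'.reg 6 ≤ n ∧ s'.reg 7 ≤ n ∧
      (F (s.reg 6) (s.reg 7) ∨ (∃ t < N, natDist M (x i) (x (l t)) ≤ dmin) →
        F (s'.reg 6) (s'.reg 7)) ∧
      (∀ q, q < 12 → q ≠ 6 → q ≠ 7 → s'.reg q = s.reg q) ∧
      s'.mem = s.mem ∧ s'.coins = s.coins := by
  have haddr : ∀ j < n, j * M + M < 2 ^ S := fun j hj =>
    lt_of_le_of_lt (Nat.add_le_add_right (Nat.mul_le_mul_right _ hj.le) _) hnM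
  refine (Runs.loop (T := stepTime S + (stepTime S + (stepTime S + ((3 * M + 1) * stepTime S +
    ((stepTime S + (stepTime S + stepTime S)) + stepTime S))))) (fun t s' =>
      s'.reg 15 = t ∧ s'.reg 6 ≤ n ∧ s'.reg 7 ≤ n ∧
      (F (s.reg 6) (s.reg 7) ∨ (∃ t' < t, natDist M (x i) (x (l t')) ≤ dmin) →
        F (s'.reg 6) (s'.reg 7)) ∧
      (∀ q, q < 12 → q ≠ 6 → q ≠ 7 → s'.reg q = s.reg q) ∧
      s'.mem = s.mem ∧ s'.coins = s.coins) N (by decide) ?_ ?_ ?_).mono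
      (le_of_eq (by ring)) fun _ h => h
  · rintro t ht s' ⟨e15, e6, e7, eF, efr, emem, eco⟩
    have e0 : s'.reg 0 = n := by rw [efr 0 (by decide) (by decide) (by decide), h0]
    have e1 : s'.reg 1 = M := by rw [efr 1 (by decide) (by decide) (by decide), h1]
    have e2 : s'.reg 2 = dmin := by rw [efr 2 (by decide) (by decide) (by decide), h2]
    have e10 : s'.reg 10 = i := by rw [efr 10 (by decide) (by decide) (by decide), h10]
    have e11 : s'.reg 11 = κ := by rw [efr 11 (by decide) (by decide) (by decide), h11]
    have hlt := hl t ht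
    have hltn := hln t ht
    refine ⟨?_, ?_, Runs.assign_seq ?_ (by decide) (Runs.assign_seq ?_ (by decide)
      (Runs.assign_seq ?_ (by decide) (Runs.seq
        (distLoop_runs (i := i) (j := l t) (f := x i) (g := x (l t)) (M := M)
          ?_ ?_ ?_ ?_ ?_ ?_ ?_ (hx1 _) (hx1 _) (by omega) (by omega) (haddr _ hi) (haddr _ hltn) hS)
        ?_)))⟩
    · simp only [and_true, true_and, Expr.Fits, Op.Fits, Expr.eval, Op.eval, e11, e0, e15, emem, hlt]
      omega
    · simp only [Expr.eval, Op.eval, e11, e0, e15, emem, hlt]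
      omega
    · simp only [and_true, true_and, Expr.Fits, Op.Fits, Expr.eval, Op.eval, e11, e0, e15, emem, hlt]
      omega
    · simp only [Expr.Fits]; omega
    · simp only [Expr.Fits]; omega
    · simp only [Expr.eval, Op.eval, Nat.reduceEqDiff, reduceIte, setReg_reg, e1]
    · simp only [Expr.eval, Op.eval, Nat.reduceEqDiff, reduceIte, setReg_reg, e10]
    · simp only [Expr.eval, Op.eval, Nat.reduceEqDiff, reduceIte, setReg_reg, e11, e0, e15, emem,
        hlt, Nat.add_sub_cancel]
    · simp only [Expr.eval, Op.eval, Nat.reduceEqDiff, reduceIte, setReg_reg]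
    · simp only [Expr.eval, Op.eval, Nat.reduceEqDiff, reduceIte, setReg_reg]
    · intro p hp
      simp only [setReg_mem, emem, hx i hi p hp]
    · intro p hp
      simp only [setReg_mem, emem, hx _ hltn p hp]
    · rintro s₁ ⟨a17, afr, amem, aco⟩
      have afr' : ∀ q, q < 12 → s₁.reg q = s'.reg q := by
        intro q hq
        rw [afr q (by omega) (by omega)]
        simp only [setReg_reg, show q ≠ 12 by omega, show q ≠ 16 by omega, show q ≠ 17 by omega,
          if_false]
      have a16 : s₁.reg 16 = l t := by
        rw [afr 16 (by decide) (by decide)]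
        simp only [Expr.eval, Op.eval, Nat.reduceEqDiff, reduceIte, setReg_reg, e11, e0, e15, emem,
          hlt, Nat.add_sub_cancel]
      have a15 : s₁.reg 15 = t := by
        rw [afr 15 (by decide) (by decide)]
        simp only [Nat.reduceEqDiff, reduceIte, setReg_reg, e15]
      rw [setReg_mem, setReg_mem, setReg_mem, emem] at amem
      rw [setReg_coins, setReg_coins, setReg_coins, eco] at aco
      have a17' : s₁.reg 17 = natDist M (x i) (x (l t)) := a17
      have a2 : s₁.reg 2 = dmin := by rw [afr' 2 (by decide), e2]
      have a10 : s₁.reg 10 = i := by rw [afr' 10 (by decide), e10]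
      have hdist := natDist_le (hx1 i) (hx1 (l t)) M
      have hiM := haddr i hi
      refine Runs.seq (Q := fun s₂ => s₂.reg 15 = t ∧ s₂.reg 6 ≤ n ∧ s₂.reg 7 ≤ n ∧
        (F (s.reg 6) (s.reg 7) ∨ (∃ t' < t + 1, natDist M (x i) (x (l t')) ≤ dmin) →
          F (s₂.reg 6) (s₂.reg 7)) ∧
        (∀ q, q < 12 → q ≠ 6 → q ≠ 7 → s₂.reg q = s.reg q) ∧
        s₂.mem = s.mem ∧ s₂.coins = s.coins) (Runs.ite ?_ (by decide) ?_ ?_) ?_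
      · simp only [and_true, true_and, Expr.Fits, Op.Fits, a17', a2]; omega
      · intro hc
        simp only [Expr.eval, Op.eval, a17', a2] at hc
        refine Runs.assign_seq ?_ (by decide) (Runs.assign ?_ (by decide) ?_)
        · simp only [Expr.Fits, a10]; omega
        · simp only [Expr.Fits, Nat.reduceEqDiff, reduceIte, setReg_reg, a16]; omega
        · simp only [Expr.eval, Nat.reduceEqDiff, reduceIte, setReg_reg, setReg_mem, setReg_coins,
            a10, a15, a16]
          refine ⟨trivial, hi.le, hltn.le, fun _ => hF t ht (by omega), fun q q1 q2 q3 => ?_, amem,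
            aco⟩
          simp only [q2, q3, if_false]
          rw [afr' q q1, efr q q1 q2 q3]
      · intro hc
        simp only [Expr.eval, Op.eval, a17', a2] at hc
        refine (Runs.skip (S := S) ?_).mono (Nat.le_add_left _ _) fun _ h => h
        refine ⟨a15, ?_, ?_, ?_, fun q q1 q2 q3 => ?_, amem, aco⟩
        · rw [afr' 6 (by decide)]; exact e6
        · rw [afr' 7 (by decide)]; exact e7
        · rw [afr' 6 (by decide), afr' 7 (by decide)]
          rintro (h | ⟨t', ht', h⟩)
          · exact eF (Or.inl h)
          · rcases eq_or_ne t' t with rfl | hne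
            · omega
            · exact eF (Or.inr ⟨t', by omega, h⟩)
        · rw [afr' q q1, efr q q1 q2 q3]
      · rintro s₂ ⟨b15, b6, b7, bF, bfr, bmem, bco⟩
        refine Runs.assign ?_ (by decide) ?_
        · simp only [and_true, true_and, Expr.Fits, Op.Fits, Expr.eval, Op.eval, b15]; omega
        · simp only [Expr.eval, Op.eval, Nat.reduceEqDiff, reduceIte, setReg_reg, setReg_mem,
            setReg_coins, b15]
          refine ⟨trivial, b6, b7, bF, fun q q1 q2 q3 => ?_, bmem, bco⟩
          rw [if_neg (by omega), bfr q q1 q2 q3]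
  · rintro s' ⟨e15, e6, e7, eF, efr, emem, eco⟩
    have e0 : s'.reg 0 = n := by rw [efr 0 (by decide) (by decide) (by decide), h0]
    have e11 : s'.reg 11 = κ := by rw [efr 11 (by decide) (by decide) (by decide), h11]
    simp only [and_true, true_and, Expr.Fits, Op.Fits, Expr.eval, Op.eval, e11, e0, e15, emem, hlN]
    omega
  · refine ⟨h15, h6, h7, ?_, fun _ _ _ _ => rfl, rfl, rfl⟩
    rintro (h | ⟨t, ht, -⟩)
    · exact h
    · omega

end Loops

/-! ### Layout of the buckets in memory: `n + 1` cells for each key -/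

theorem addr_inj {n κ κ' t t' : ℕ} (ht : t ≤ n) (ht' : t' ≤ n)
    (h : κ * (n + 1) + t = κ' * (n + 1) + t') : κ = κ' ∧ t = t' := by
  have h1 : (κ * (n + 1) + t) / (n + 1) = κ := by
    rw [mul_comm, Nat.mul_add_div (by omega), Nat.div_eq_of_lt (by omega), add_zero]
  have h2 : (κ' * (n + 1) + t') / (n + 1) = κ' := by
    rw [mul_comm, Nat.mul_add_div (by omega), Nat.div_eq_of_lt (by omega), add_zero]
  have h3 : κ = κ' := by rw [← h1, h, h2]
  subst h3
  exact ⟨rfl, by omega⟩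

/-- The content of the cell number `t` of a bucket with the entries `L`. -/
def slot (L : List ℕ) (t : ℕ) : ℕ := (L.map (· + 1)).getD t 0

theorem slot_of_lt {L : List ℕ} {t : ℕ} (h : t < L.length) : slot L t = L.getD t 0 + 1 := by
  simp [slot, List.getD_eq_getElem?_getD, h]

theorem slot_length (L : List ℕ) : slot L L.length = 0 := by
  simp [slot, List.getD_eq_getElem?_getD]

theorem slot_append_singleton (L : List ℕ) (i t : ℕ) :
    slot (L ++ [i]) t = if t = L.length then i + 1 else slot L t := by
  rcases lt_trichotomy t L.length with h | h | h
  · simp [slot, List.getD_eq_getElem?_getD, List.getElem?_append, h, h.ne]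
  · subst h
    simp [slot, List.getD_eq_getElem?_getD]
  · have h1 : ¬ t < L.length := by omega
    have h2 : t - L.length ≠ 0 := by omega
    simp [slot, List.getD_eq_getElem?_getD, List.getElem?_append, h1, h2, h.le, h.ne']

/-- The vectors with numbers below `i` that have key `κ`. -/
def bucket (key : ℕ → ℕ) (i κ : ℕ) : List ℕ := (List.range i).filter fun j => key j = κ

theorem mem_bucket {key : ℕ → ℕ} {i κ j : ℕ} : j ∈ bucket key i κ ↔ j < i ∧ key j = κ := by
  simp [bucket]

theorem bucket_length_le (key : ℕ → ℕ) (i κ : ℕ) : (bucket key i κ).length ≤ i :=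
  (List.length_filter_le _ _).trans (by simp)

/-- Processing the vector `i` changes a single cell, matching the single store of the program. -/
theorem slot_bucket_succ (key : ℕ → ℕ) (i κ t : ℕ) :
    slot (bucket key (i + 1) κ) t =
      if κ = key i ∧ t = (bucket key i κ).length then i + 1 else slot (bucket key i κ) t := by
  by_cases h : key i = κ
  · have h1 : bucket key (i + 1) κ = bucket key i κ ++ [i] := by
      simp [bucket, List.range_succ, h]
    rw [h1, slot_append_singleton]
    simp [h.symm]
  · have h1 : bucket key (i + 1) κ = bucket key i κ := by
      simp [bucket, List.range_succ, h]
    rw [h1, if_neg fun h2 => h h2.1.symm]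

/-! ### One pass over the vectors, the coins, the repetitions, and the setup -/

section Loops

variable {m : ℕ} {dec : Cube m → Cube m} {ω : ℕ → Bool} {s : State} {S : ℕ}

/-- The invariant says that the memory region of `ρ` holds the buckets of the vectors treated so
far. It starts empty by `hzero`, and everything below it, in particular the input, stays intact. -/
theorem vecLoop_runs {n M dmin u ρ r B : ℕ} {x : ℕ → ℕ → ℕ} {F : ℕ → ℕ → Prop} {key : ℕ → ℕ}
    (hkey : ∀ i, key i = keyNum (x i) M u r ρ)
    (h0 : s.reg 0 = n) (h1 : s.reg 1 = M) (h2 : s.reg 2 = dmin) (h4 : s.reg 4 = u)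
    (h5 : s.reg 5 = ρ) (h6 : s.reg 6 ≤ n) (h7 : s.reg 7 ≤ n) (h8 : s.reg 8 = r)
    (h10 : s.reg 10 = 0) (hρ : 1 ≤ ρ)
    (hx : ∀ j < n, ∀ p < M, s.mem (j * M + p) = x j p) (hx1 : ∀ j p, x j p ≤ 1)
    (hzero : ∀ a, ρ * 2 ^ M * (n + 1) ≤ a → a < (ρ + 1) * 2 ^ M * (n + 1) → s.mem a = 0)
    (hB : ∀ i < n, (bucket key i (key i)).length ≤ B)
    (hF : ∀ i < n, ∀ j < i, natDist M (x i) (x j) ≤ dmin → F i j)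
    (hV : (ρ + 1) * 2 ^ M * (n + 1) ≤ 2 ^ S) (hr : r < 2 ^ S) (hu : u < 2 ^ S) (hd : dmin ≤ M) :
    Runs dec ω vecLoop s ((n * (6 * M + 10 + B * (3 * M + 9)) + 1) * stepTime S) fun s' =>
      s'.reg 6 ≤ n ∧ s'.reg 7 ≤ n ∧
      (F (s.reg 6) (s.reg 7) ∨
        (∃ i < n, ∃ j < i, key j = key i ∧ natDist M (x i) (x j) ≤ dmin) →
        F (s'.reg 6) (s'.reg 7)) ∧
      (∀ q, q < 10 → q ≠ 6 → q ≠ 7 → s'.reg q = s.reg q) ∧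
      (∀ a < ρ * 2 ^ M * (n + 1), s'.mem a = s.mem a) ∧ s'.coins = s.coins := by
  have hM : M < 2 ^ M := Nat.lt_two_pow_self
  have hpn : M * (n + 1) < 2 ^ M * (n + 1) := Nat.mul_lt_mul_of_pos_right hM (by omega)
  have hρV : 2 ^ M * (n + 1) ≤ ρ * 2 ^ M * (n + 1) :=
    Nat.mul_le_mul_right _ (Nat.le_mul_of_pos_left _ hρ)
  have hsplit : (ρ + 1) * 2 ^ M * (n + 1) = ρ * 2 ^ M * (n + 1) + 2 ^ M * (n + 1) := by ring
  have hnM : n * M + M < 2 ^ S := by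
    have : n * M + M = M * (n + 1) := by ring
    omega
  have hn2 : n + 1 ≤ 2 ^ M * (n + 1) := Nat.le_mul_of_pos_left _ (by positivity)
  have hn : n + 1 < 2 ^ S := by omega
  have hρS : ρ < 2 ^ S := by
    have : ρ ≤ ρ * 2 ^ M * (n + 1) := by
      rw [mul_assoc]
      exact Nat.le_mul_of_pos_right _ (by positivity)
    omega
  have hklo : ∀ i, ρ * 2 ^ M ≤ key i := fun i => (hkey i).symm ▸ le_keyNum _ _ _ _ _
  have hkhi : ∀ i, key i < (ρ + 1) * 2 ^ M := fun i => (hkey i).symm ▸ keyNum_lt (hx1 i) _ _ _ _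
  have hcell : ∀ κ < (ρ + 1) * 2 ^ M, ∀ t ≤ n, κ * (n + 1) + t < (ρ + 1) * 2 ^ M * (n + 1) := by
    intro κ hκ t ht
    calc κ * (n + 1) + t < (κ + 1) * (n + 1) := by rw [add_mul]; omega
      _ ≤ _ := Nat.mul_le_mul_right _ hκ
  have hcell' : ∀ κ, ρ * 2 ^ M ≤ κ → ∀ t, ρ * 2 ^ M * (n + 1) ≤ κ * (n + 1) + t := fun κ hκ t =>
    (Nat.mul_le_mul_right _ hκ).trans (Nat.le_add_right _ _)
  refine (Runs.loop (T := (6 * M + 9 + B * (3 * M + 9)) * stepTime S) (fun i s' =>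
      s'.reg 10 = i ∧ s'.reg 6 ≤ n ∧ s'.reg 7 ≤ n ∧
      (F (s.reg 6) (s.reg 7) ∨
        (∃ i' < i, ∃ j < i', key j = key i' ∧ natDist M (x i') (x j) ≤ dmin) →
        F (s'.reg 6) (s'.reg 7)) ∧
      (∀ q, q < 10 → q ≠ 6 → q ≠ 7 → s'.reg q = s.reg q) ∧
      (∀ a < ρ * 2 ^ M * (n + 1), s'.mem a = s.mem a) ∧
      (∀ κ, ρ * 2 ^ M ≤ κ → κ < (ρ + 1) * 2 ^ M → ∀ t ≤ n,
        s'.mem (κ * (n + 1) + t) = slot (bucket key i κ) t) ∧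
      s'.coins = s.coins) n (by decide) ?_ ?_ ?_).mono (le_of_eq (by ring)) ?_
  · rintro i hi s' ⟨e10, e6, e7, eF, efr, elow, ebuck, eco⟩
    have e0 : s'.reg 0 = n := by rw [efr 0 (by decide) (by decide) (by decide), h0]
    have e1 : s'.reg 1 = M := by rw [efr 1 (by decide) (by decide) (by decide), h1]
    have e2 : s'.reg 2 = dmin := by rw [efr 2 (by decide) (by decide) (by decide), h2]
    have e4 : s'.reg 4 = u := by rw [efr 4 (by decide) (by decide) (by decide), h4]
    have e5 : s'.reg 5 = ρ := by rw [efr 5 (by decide) (by decide) (by decide), h5]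
    have e8 : s'.reg 8 = r := by rw [efr 8 (by decide) (by decide) (by decide), h8]
    have hin : ∀ j < n, ∀ p < M, s'.mem (j * M + p) = x j p := by
      intro j hj p hp
      -- The input lies below `M * (n + 1)`, hence below the region of the buckets because `ρ ≥ 1`.
      rw [elow _ ?_, hx j hj p hp]
      have h3 : j * M + p < M * (n + 1) := by nlinarith
      omega
    have hiM : i * M + M < 2 ^ S :=
      lt_of_le_of_lt (Nat.add_le_add_right (Nat.mul_le_mul_right _ hi.le) _) hnM
    have hkS : key i * (n + 1) + n < 2 ^ S := (hcell _ (hkhi i) n le_rfl).trans_le hV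
    have hkS' : key i < 2 ^ S := by
      have : key i ≤ key i * (n + 1) := Nat.le_mul_of_pos_right _ (by omega)
      omega
    set N := (bucket key i (key i)).length with hNdef
    have hNi : N ≤ i := bucket_length_le _ _ _
    have hNB : N ≤ B := hB i hi
    refine ⟨?_, ?_, ?_⟩
    · simp only [and_true, true_and, Expr.Fits, Op.Fits, e0, e10]; omega
    · simp only [Expr.eval, Op.eval, e0, e10]; omega
    refine Runs.mono (T := stepTime S + (stepTime S + (stepTime S + (stepTime S +
      ((6 * M + 1) * stepTime S + (stepTime S + ((N * (3 * M + 9) + 1) * stepTime S +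
        (stepTime S + stepTime S)))))))) ?_ ?_ fun _ h => h
    · refine Runs.assign_seq ?_ (by decide) (Runs.assign_seq ?_ (by decide)
        (Runs.assign_seq ?_ (by decide) (Runs.assign_seq ?_ (by decide) (Runs.seq
        (keyLoop_runs (i := i) (f := x i) (M := M) (k := ρ) (r := r) (u := u)
          ?_ ?_ ?_ ?_ ?_ ?_ ?_ (by omega) hiM hr hu ((hkey i) ▸ hkS') (by omega)) ?_))))
      · simp only [Expr.Fits, e5]; exact hρS
      · simp only [Expr.Fits, Nat.reduceEqDiff, reduceIte, setReg_reg, e1]; omega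
      · simp only [Expr.Fits, Nat.reduceEqDiff, reduceIte, setReg_reg, e8]; exact hr
      · simp only [Expr.Fits, Nat.reduceEqDiff, reduceIte, setReg_reg, e4]; exact hu
      · simp only [Expr.eval, Nat.reduceEqDiff, reduceIte, setReg_reg, e1]
      · simp only [Expr.eval, Nat.reduceEqDiff, reduceIte, setReg_reg, e10]
      · simp only [Expr.eval, Nat.reduceEqDiff, reduceIte, setReg_reg, e5]
      · simp only [Expr.eval, Nat.reduceEqDiff, reduceIte, setReg_reg, e1]
      · simp only [Expr.eval, Nat.reduceEqDiff, reduceIte, setReg_reg, e8]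
      · simp only [Expr.eval, Nat.reduceEqDiff, reduceIte, setReg_reg, e4]
      · intro p hp
        simp only [setReg_mem]
        exact hin i hi p hp
      rintro s₁ ⟨a11, afr, amem, aco⟩
      rw [← hkey i] at a11
      have afr' : ∀ q, q < 11 → s₁.reg q = s'.reg q := by
        intro q hq
        rw [afr q (by omega) (by omega) (by omega) (by omega)]
        simp only [setReg_reg, show q ≠ 11 by omega, show q ≠ 12 by omega, show q ≠ 13 by omega,
          show q ≠ 14 by omega, if_false]
      simp only [setReg_mem] at amem
      simp only [setReg_coins] at aco
      refine Runs.assign_seq ?_ (by decide) (Runs.seq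
        (probeLoop_runs (n := n) (M := M) (dmin := dmin) (i := i) (κ := key i) (N := N)
          (x := x) (l := fun t => (bucket key i (key i)).getD t 0) (F := F)
          ?_ ?_ ?_ ?_ ?_ ?_ ?_ ?_ ?_ hx1 hi ?_ ?_ ?_ (by omega) ?_ hkS hkS' hn hnM (by omega)
          (by omega)) ?_)
      · simp only [Expr.Fits]; omega
      · simp only [Nat.reduceEqDiff, reduceIte, setReg_reg, afr' 0 (by decide), e0]
      · simp only [Nat.reduceEqDiff, reduceIte, setReg_reg, afr' 1 (by decide), e1]
      · simp only [Nat.reduceEqDiff, reduceIte, setReg_reg, afr' 2 (by decide), e2]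
      · simp only [Nat.reduceEqDiff, reduceIte, setReg_reg, afr' 10 (by decide), e10]
      · simp only [Nat.reduceEqDiff, reduceIte, setReg_reg, a11]
      · simp only [Expr.eval, reduceIte, setReg_reg]
      · simp only [Nat.reduceEqDiff, reduceIte, setReg_reg, afr' 6 (by decide), e6]
      · simp only [Nat.reduceEqDiff, reduceIte, setReg_reg, afr' 7 (by decide), e7]
      · intro j hj p hp
        simp only [setReg_mem, amem]
        exact hin j hj p hp
      · intro t ht
        simp only [setReg_mem, amem]
        rw [ebuck _ (hklo i) (hkhi i) t (by omega), slot_of_lt ht]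
      · intro t ht
        have : (bucket key i (key i)).getD t 0 ∈ bucket key i (key i) := by
          rw [List.getD_eq_getElem _ _ ht]; exact List.getElem_mem ht
        exact (mem_bucket.1 this).1.trans hi
      · simp only [setReg_mem, amem]
        rw [ebuck _ (hklo i) (hkhi i) N (by omega), hNdef, slot_length]
      · intro t ht
        have : (bucket key i (key i)).getD t 0 ∈ bucket key i (key i) := by
          rw [List.getD_eq_getElem _ _ ht]; exact List.getElem_mem ht
        exact hF i hi _ (mem_bucket.1 this).1
      rintro s₂ ⟨b15, b6, b7, bF, bfr, bmem, bco⟩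
      simp only [setReg_mem, amem] at bmem
      simp only [setReg_coins, aco] at bco
      have b11 : s₂.reg 11 = key i := by
        rw [bfr 11 (by decide) (by decide) (by decide)]
        simp only [Nat.reduceEqDiff, reduceIte, setReg_reg, a11]
      have bfr' : ∀ q, q < 11 → q ≠ 6 → q ≠ 7 → s₂.reg q = s'.reg q := by
        intro q q1 q2 q3
        rw [bfr q (by omega) q2 q3, setReg_reg, if_neg (by omega), afr' q q1]
      have b0 : s₂.reg 0 = n := by rw [bfr' 0 (by decide) (by decide) (by decide), e0]
      have b10 : s₂.reg 10 = i := by rw [bfr' 10 (by decide) (by decide) (by decide), e10]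
      refine Runs.seq (Q := fun s₃ => s₃ = s₂.setMem (key i * (n + 1) + N) (i + 1))
        (Runs.store ?_ (by decide) ?_ (by decide) ?_) ?_
      · simp only [and_true, true_and, Expr.Fits, Op.Fits, Expr.eval, Op.eval, b11, b0, b15]
        omega
      · simp only [and_true, true_and, Expr.Fits, Op.Fits, Expr.eval, Op.eval, b10]
        omega
      · simp only [Expr.eval, Op.eval, b11, b0, b15, b10]
      rintro _ rfl
      refine Runs.assign ?_ (by decide) ?_
      · simp only [and_true, true_and, Expr.Fits, Op.Fits, Expr.eval, Op.eval, setMem_reg, b10]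
        omega
      simp only [Expr.eval, Op.eval, Nat.reduceEqDiff, reduceIte, setReg_reg, setReg_mem,
        setReg_coins, setMem_reg, setMem_mem, setMem_coins, b10]
      refine ⟨trivial, b6, b7, ?_, ?_, ?_, ?_, ?_⟩
      · intro h
        apply bF
        simp only [Nat.reduceEqDiff, reduceIte, setReg_reg, afr' 6 (by decide), afr' 7 (by decide)]
        rcases h with h | ⟨i', hi', j, hj, hk, hdist⟩
        · exact Or.inl (eF (Or.inl h))
        · rcases eq_or_ne i' i with rfl | hne
          · right
            have hmem : j ∈ bucket key i' (key i') := mem_bucket.2 ⟨hj, hk⟩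
            obtain ⟨t, ht, rfl⟩ := List.getElem_of_mem hmem
            refine ⟨t, ht, ?_⟩
            rwa [List.getD_eq_getElem _ _ ht]
          · exact Or.inl (eF (Or.inr ⟨i', by omega, j, hj, hk, hdist⟩))
      · intro q q1 q2 q3
        rw [if_neg (by omega), bfr' q (by omega) q2 q3, efr q q1 q2 q3]
      · intro a ha
        rw [if_neg ?_, bmem, elow a ha]
        have := hcell' _ (hklo i) N
        omega
      · intro κ hκ hκ' t ht
        rw [slot_bucket_succ]
        by_cases hc : κ = key i ∧ t = (bucket key i κ).length
        · have hc1 := hc.1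
          rw [if_pos hc, if_pos]
          rw [hc.2, hc1]
        · rw [if_neg hc, if_neg, bmem, ebuck κ hκ hκ' t ht]
          -- Buckets of distinct keys do not overlap, since no bucket index exceeds `n`.
          intro hadd
          obtain ⟨rfl, rfl⟩ := addr_inj ht (by omega) hadd
          exact hc ⟨rfl, rfl⟩
      · rw [bco, eco]
    · have h3 : N * (3 * M + 9) * stepTime S ≤ B * (3 * M + 9) * stepTime S :=
        Nat.mul_le_mul_right _ (Nat.mul_le_mul_right _ hNB)
      linarith
  · rintro s' ⟨e10, e6, e7, eF, efr, elow, ebuck, eco⟩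
    have e0 : s'.reg 0 = n := by rw [efr 0 (by decide) (by decide) (by decide), h0]
    simp only [and_true, true_and, Expr.Fits, Op.Fits, Expr.eval, Op.eval, e0, e10]
    omega
  · refine ⟨h10, h6, h7, ?_, fun _ _ _ _ => rfl, fun _ _ => rfl, ?_, rfl⟩
    · rintro (h | ⟨i, hi, -⟩)
      · exact h
      · omega
    · intro κ hκ hκ' t ht
      rw [hzero _ (hcell' κ hκ t) (hcell κ hκ' t ht)]
      simp [slot, bucket]
  · rintro s' ⟨-, e6, e7, eF, efr, elow, -, eco⟩
    exact ⟨e6, e7, eF, efr, elow, eco⟩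

theorem coinLoop_runs {M c : ℕ} (h1 : s.reg 1 = M) (h8 : s.reg 8 = 0) (h9 : s.reg 9 = 0)
    (hc : s.coins = c) (hK : M * M < S) :
    Runs dec ω coinLoop s ((4 * (M * M) + 1) * stepTime S) fun s' =>
      s'.reg 8 = coinNum ω c (M * M) ∧ (∀ q, q < 8 → s'.reg q = s.reg q) ∧ s'.mem = s.mem ∧
      s'.coins = c + M * M := by
  -- For `M = 0` the word length `S` may be `1`, but then the loop body is never entered.
  have hS : 2 < 2 ^ S ∨ M = 0 := by
    rcases Nat.eq_zero_or_pos M with h | h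
    · exact Or.inr h
    · have : 1 ≤ M * M := Nat.mul_pos h h
      left
      calc 2 < 2 ^ 2 := by norm_num
        _ ≤ 2 ^ S := Nat.pow_le_pow_right (by norm_num) (by omega)
  have hKS : M * M < 2 ^ S := hK.trans Nat.lt_two_pow_self
  have hMM : M ≤ M * M := Nat.le_mul_self M
  refine (Runs.loop (T := stepTime S + (stepTime S + stepTime S)) (fun k s' => s'.reg 9 = k ∧
    s'.reg 8 = coinNum ω c k ∧ (∀ q, q < 8 → s'.reg q = s.reg q) ∧ s'.mem = s.mem ∧
    s'.coins = c + k) (M * M) (by decide) ?_ ?_ ?_).mono (le_of_eq (by ring)) ?_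
  · rintro k hk s' ⟨e9, e8, efr, emem, eco⟩
    have e1 : s'.reg 1 = M := by rw [efr 1 (by decide), h1]
    have hlt : coinNum ω c (k + 1) < 2 ^ S :=
      (coinNum_lt ω c (k + 1)).trans_le (Nat.pow_le_pow_right (by norm_num) (by omega))
    have hS' : 2 < 2 ^ S := by
      rcases hS with h | h
      · exact h
      · subst h; omega
    have hb := Bool.toNat_le (ω (c + k))
    rw [coinNum] at hlt
    refine ⟨?_, ?_, Runs.seq (Q := fun s₁ => s₁ =
      { s'.setReg 10 (ω s'.coins).toNat with coins := s'.coins + 1 }) (Runs.flip rfl) ?_⟩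
    · simp only [and_true, true_and, Expr.Fits, Op.Fits, Expr.eval, e1, e9]; omega
    · simp only [Expr.eval, Op.eval, e1, e9]; omega
    rintro _ rfl
    refine Runs.assign_seq ?_ (by decide) (Runs.assign ?_ (by decide) ?_)
    · simp only [and_true, true_and, Expr.Fits, Op.Fits, Expr.eval, Op.eval, Nat.reduceEqDiff,
        reduceIte, setReg_reg, e8, eco]
      omega
    · simp only [and_true, true_and, Expr.Fits, Op.Fits, Expr.eval, Op.eval, Nat.reduceEqDiff,
        reduceIte, setReg_reg, e9]
      omega
    · simp only [Expr.eval, Op.eval, Nat.reduceEqDiff, reduceIte, setReg_reg, setReg_mem,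
        setReg_coins, e8, e9, eco, coinNum]
      refine ⟨trivial, trivial, fun q hq => ?_, emem, by omega⟩
      rw [if_neg (by omega), if_neg (by omega), if_neg (by omega), efr q hq]
  · rintro s' ⟨e9, e8, efr, emem, eco⟩
    have e1 : s'.reg 1 = M := by rw [efr 1 (by decide), h1]
    simp only [and_true, true_and, Expr.Fits, Op.Fits, Expr.eval, Op.eval, e1, e9]
    omega
  · exact ⟨h9, by simpa [coinNum] using h8, fun _ _ => rfl, rfl, hc⟩
  · rintro s' ⟨-, e8, efr, emem, eco⟩
    exact ⟨e8, efr, emem, eco⟩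

/-- The time of one repetition, in elementary steps. -/
def repSteps (n M B : ℕ) : ℕ := 4 * (M * M) + n * (6 * M + 10 + B * (3 * M + 9)) + 7

/-- Since `ρ` decreases from `R` to `1`, the regions are used from the top downwards. The memory
below the current end is still in its initial state, so the next buckets start empty. -/
theorem repLoop_runs {n M dmin u R B : ℕ} {x : ℕ → ℕ → ℕ} {F : ℕ → ℕ → Prop}
    (h0 : s.reg 0 = n) (h1 : s.reg 1 = M) (h2 : s.reg 2 = dmin) (h4 : s.reg 4 = u)
    (h5 : s.reg 5 = R) (h6 : s.reg 6 ≤ n) (h7 : s.reg 7 ≤ n) (hc : s.coins = 0)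
    (hx : ∀ j < n, ∀ p < M, s.mem (j * M + p) = x j p) (hx1 : ∀ j p, x j p ≤ 1)
    (hzero : ∀ a, n * M ≤ a → s.mem a = 0)
    (hB : ∀ r ρ, ∀ i < n, (bucket (fun j => keyNum (x j) M u r ρ) i
      (keyNum (x i) M u r ρ)).length ≤ B)
    (hF : ∀ i < n, ∀ j < i, natDist M (x i) (x j) ≤ dmin → F i j)
    (hV : (R + 1) * 2 ^ M * (n + 1) ≤ 2 ^ S) (hK : M * M < S) (hu : u ≤ M) (hd : dmin ≤ M) :
    Runs dec ω repLoop s ((R * repSteps n M B + 1) * stepTime S) fun s' =>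
      s'.reg 6 ≤ n ∧ s'.reg 7 ≤ n ∧
      ((∃ k < R, ∃ i < n, ∃ j < i,
          (∀ q < M, q ∉ selSet M u (coinNum ω (k * (M * M)) (M * M)) → x j q = x i q) ∧
          natDist M (x i) (x j) ≤ dmin) → F (s'.reg 6) (s'.reg 7)) := by
  have hM : M < 2 ^ M := Nat.lt_two_pow_self
  have hpn : M * (n + 1) < 2 ^ M * (n + 1) := Nat.mul_lt_mul_of_pos_right hM (by omega)
  have hnM : n * M + M = M * (n + 1) := by ring
  have hbig : ∀ k < R, 2 ^ M * (n + 1) ≤ (R - k) * 2 ^ M * (n + 1) := fun k hk =>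
    Nat.mul_le_mul_right _ (Nat.le_mul_of_pos_left _ (by omega))
  have hRS : R + 1 ≤ 2 ^ S := by
    refine le_trans ?_ hV
    rw [mul_assoc]
    exact Nat.le_mul_of_pos_right _ (by positivity)
  have hVS : 2 ^ M * (n + 1) ≤ 2 ^ S := by
    refine le_trans ?_ hV
    exact Nat.mul_le_mul_right _ (Nat.le_mul_of_pos_left _ (by omega))
  have hMS : M < 2 ^ S := by
    have : M ≤ M * (n + 1) := Nat.le_mul_of_pos_right _ (by omega)
    omega
  refine (Runs.loop (T := stepTime S + (stepTime S + ((4 * (M * M) + 1) * stepTime S +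
      (stepTime S + ((n * (6 * M + 10 + B * (3 * M + 9)) + 1) * stepTime S + stepTime S)))))
    (fun k s' => s'.reg 5 = R - k ∧ s'.reg 6 ≤ n ∧ s'.reg 7 ≤ n ∧
      ((∃ k' < k, ∃ i < n, ∃ j < i,
          (∀ q < M, q ∉ selSet M u (coinNum ω (k' * (M * M)) (M * M)) → x j q = x i q) ∧
          natDist M (x i) (x j) ≤ dmin) → F (s'.reg 6) (s'.reg 7)) ∧
      (∀ q, q < 5 → s'.reg q = s.reg q) ∧
      (∀ a < (R - k + 1) * 2 ^ M * (n + 1), s'.mem a = s.mem a) ∧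
      s'.coins = k * (M * M)) R (by decide) ?_ ?_ ?_).mono (le_of_eq (by rw [repSteps]; ring)) ?_
  · rintro k hk s' ⟨e5, e6, e7, eF, efr, emem, eco⟩
    have hkb := hbig k hk
    have hsplit : (R - k + 1) * 2 ^ M * (n + 1) =
      (R - k) * 2 ^ M * (n + 1) + 2 ^ M * (n + 1) := by ring
    have hrk : R - (k + 1) + 1 = R - k := by omega
    refine ⟨?_, ?_, Runs.assign_seq ?_ (by decide) (Runs.assign_seq ?_ (by decide) (Runs.seq
      (coinLoop_runs (M := M) (c := k * (M * M)) ?_ ?_ ?_ ?_ hK) ?_))⟩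
    · simp only [Expr.Fits, e5]; omega
    · simp only [Expr.eval, e5]; omega
    · simp only [Expr.Fits]; omega
    · simp only [Expr.Fits]; omega
    · simp only [Nat.reduceEqDiff, reduceIte, setReg_reg, efr 1 (by decide), h1]
    · simp only [Expr.eval, Nat.reduceEqDiff, reduceIte, setReg_reg]
    · simp only [Expr.eval, Nat.reduceEqDiff, reduceIte, setReg_reg]
    · simp only [setReg_coins, eco]
    rintro s₁ ⟨a8, afr, amem, aco⟩
    have afr' : ∀ q, q < 8 → s₁.reg q = s'.reg q := by
      intro q hq
      rw [afr q hq, setReg_reg, setReg_reg, if_neg (by omega), if_neg (by omega)]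
    simp only [setReg_mem] at amem
    refine Runs.assign_seq ?_ (by decide) (Runs.seq
      (vecLoop_runs (n := n) (M := M) (dmin := dmin) (u := u) (ρ := R - k)
        (r := coinNum ω (k * (M * M)) (M * M)) (B := B) (x := x) (F := F)
        (fun _ => rfl) ?_ ?_ ?_ ?_ ?_ ?_ ?_ ?_ ?_ (by omega) ?_ hx1 ?_ (hB _ _) hF ?_ ?_
        (by omega) hd) ?_)
    · simp only [Expr.Fits]; omega
    · simp only [Nat.reduceEqDiff, reduceIte, setReg_reg, afr' 0 (by decide), efr 0 (by decide), h0]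
    · simp only [Nat.reduceEqDiff, reduceIte, setReg_reg, afr' 1 (by decide), efr 1 (by decide), h1]
    · simp only [Nat.reduceEqDiff, reduceIte, setReg_reg, afr' 2 (by decide), efr 2 (by decide), h2]
    · simp only [Nat.reduceEqDiff, reduceIte, setReg_reg, afr' 4 (by decide), efr 4 (by decide), h4]
    · simp only [Nat.reduceEqDiff, reduceIte, setReg_reg, afr' 5 (by decide), e5]
    · simp only [Nat.reduceEqDiff, reduceIte, setReg_reg, afr' 6 (by decide), e6]
    · simp only [Nat.reduceEqDiff, reduceIte, setReg_reg, afr' 7 (by decide), e7]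
    · simp only [Nat.reduceEqDiff, reduceIte, setReg_reg, a8]
    · simp only [Expr.eval, reduceIte, setReg_reg]
    · intro j hj p hp
      have h3 : j * M + p < M * (n + 1) := by nlinarith
      simp only [setReg_mem, amem]
      rw [emem _ (by omega), hx j hj p hp]
    · intro a ha ha'
      simp only [setReg_mem, amem]
      rw [emem a ha', hzero a (by omega)]
    · exact (Nat.mul_le_mul_right _ (Nat.mul_le_mul_right _ (by omega))).trans hV
    · exact (coinNum_lt _ _ _).trans_le (Nat.pow_le_pow_right (by norm_num) hK.le)
    rintro s₂ ⟨b6, b7, bF, bfr, bmem, bco⟩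
    have bfr' : ∀ q, q < 6 → s₂.reg q = s'.reg q := by
      intro q hq
      rw [bfr q (by omega) (by omega) (by omega), setReg_reg, if_neg (by omega), afr' q (by omega)]
    have b5 : s₂.reg 5 = R - k := by rw [bfr' 5 (by decide), e5]
    simp only [setReg_mem, amem] at bmem
    simp only [setReg_coins, aco] at bco
    simp only [Nat.reduceEqDiff, reduceIte, setReg_reg, afr' 6 (by decide), afr' 7 (by decide)]
      at bF
    refine Runs.assign ?_ (by decide) ?_
    · simp only [and_true, true_and, Expr.Fits, Op.Fits, b5]; omega
    simp only [Expr.eval, Op.eval, Nat.reduceEqDiff, reduceIte, setReg_reg, setReg_mem,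
      setReg_coins, b5]
    refine ⟨by omega, b6, b7, ?_, fun q hq => ?_, fun a ha => ?_, ?_⟩
    · rintro ⟨k', hk', i, hi, j, hj, hsel, hdist⟩
      apply bF
      rcases eq_or_ne k' k with rfl | hne
      · exact Or.inr ⟨i, hi, j, hj, (keyNum_eq_iff (hx1 j) (hx1 i) _ _ _ _ _).2 ⟨rfl, hsel⟩, hdist⟩
      · exact Or.inl (eF ⟨k', by omega, i, hi, j, hj, hsel, hdist⟩)
    · rw [if_neg (by omega), bfr' q (by omega), efr q hq]
    · rw [hrk] at ha
      rw [bmem a ha, emem a (by omega)]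
    · rw [bco]; ring
  · rintro s' ⟨e5, -⟩
    simp only [Expr.Fits, Expr.eval, e5]
    omega
  · refine ⟨h5, h6, h7, ?_, fun _ _ => rfl, fun _ _ => rfl, by rw [hc, zero_mul]⟩
    rintro ⟨k, hk, -⟩
    omega
  · rintro s' ⟨-, e6, e7, eF, -⟩
    exact ⟨e6, e7, eF⟩

theorem descFactorial_lt_two_pow {N M k : ℕ} (hN : N ≤ M) (hk : k ≤ M) (hK : M * M < S) :
    N.descFactorial k < 2 ^ S := by
  calc N.descFactorial k ≤ N ^ k := Nat.descFactorial_le_pow N k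
    _ ≤ (2 ^ M) ^ k := Nat.pow_le_pow_left (hN.trans Nat.lt_two_pow_self.le) k
    _ = 2 ^ (M * k) := (pow_mul 2 M k).symm
    _ < 2 ^ S := Nat.pow_lt_pow_right (by norm_num)
        (lt_of_le_of_lt (Nat.mul_le_mul_left M hk) hK)

theorem ratioLoop_runs {M dmin u : ℕ} (h1 : s.reg 1 = M) (h2 : s.reg 2 = dmin) (h4 : s.reg 4 = u)
    (h8 : s.reg 8 = 1) (h9 : s.reg 9 = 1) (h10 : s.reg 10 = 0) (hK : M * M < S) (hu : u ≤ M)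
    (hd : dmin ≤ M) (hM : M + 1 < 2 ^ S) :
    Runs dec ω ratioLoop s ((4 * dmin + 1) * stepTime S) fun s' =>
      s'.reg 8 = M.descFactorial dmin ∧ s'.reg 9 = u.descFactorial dmin ∧
      (∀ q, q < 8 → s'.reg q = s.reg q) ∧ s'.mem = s.mem ∧ s'.coins = s.coins := by
  refine (Runs.loop (T := stepTime S + (stepTime S + stepTime S)) (fun k s' => s'.reg 10 = k ∧
    s'.reg 8 = M.descFactorial k ∧ s'.reg 9 = u.descFactorial k ∧
    (∀ q, q < 8 → s'.reg q = s.reg q) ∧ s'.mem = s.mem ∧ s'.coins = s.coins) dmin (by decide)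
    ?_ ?_ ?_).mono (le_of_eq (by ring)) ?_
  · rintro k hk s' ⟨e10, e8, e9, efr, emem, eco⟩
    have e1 : s'.reg 1 = M := by rw [efr 1 (by decide), h1]
    have e2 : s'.reg 2 = dmin := by rw [efr 2 (by decide), h2]
    have e4 : s'.reg 4 = u := by rw [efr 4 (by decide), h4]
    have b1 : M.descFactorial k < 2 ^ S := descFactorial_lt_two_pow le_rfl (by omega) hK
    have b2 : u.descFactorial k < 2 ^ S := descFactorial_lt_two_pow hu (by omega) hK
    have b3 : M.descFactorial (k + 1) < 2 ^ S := descFactorial_lt_two_pow le_rfl (by omega) hK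
    have b4 : u.descFactorial (k + 1) < 2 ^ S := descFactorial_lt_two_pow hu (by omega) hK
    rw [Nat.descFactorial_succ, mul_comm] at b3 b4
    refine ⟨?_, ?_, Runs.assign_seq ?_ (by decide) (Runs.assign_seq ?_ (by decide)
      (Runs.assign ?_ (by decide) ?_))⟩
    · simp only [and_true, true_and, Expr.Fits, Op.Fits, e2, e10]; omega
    · simp only [Expr.eval, Op.eval, e2, e10]; omega
    · simp only [and_true, true_and, Expr.Fits, Op.Fits, Expr.eval, Op.eval, e1, e8, e10]
      refine ⟨b1, ⟨?_, ?_⟩, b3⟩ <;> omega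
    · simp only [and_true, true_and, Expr.Fits, Op.Fits, Expr.eval, Op.eval, Nat.reduceEqDiff,
        reduceIte, setReg_reg, e4, e9, e10]
      refine ⟨b2, ⟨?_, ?_⟩, b4⟩ <;> omega
    · simp only [and_true, true_and, Expr.Fits, Op.Fits, Expr.eval, Op.eval, Nat.reduceEqDiff,
        reduceIte, setReg_reg, e10]
      omega
    · simp only [Expr.eval, Op.eval, Nat.reduceEqDiff, reduceIte, setReg_reg, setReg_mem,
        setReg_coins, e1, e4, e8, e9, e10, Nat.descFactorial_succ]
      refine ⟨trivial, mul_comm _ _, mul_comm _ _, fun q hq => ?_, emem, eco⟩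
      rw [if_neg (by omega), if_neg (by omega), if_neg (by omega), efr q hq]
  · rintro s' ⟨e10, e8, e9, efr, emem, eco⟩
    have e2 : s'.reg 2 = dmin := by rw [efr 2 (by decide), h2]
    simp only [and_true, true_and, Expr.Fits, Op.Fits, Expr.eval, Op.eval, e2, e10]
    omega
  · exact ⟨h10, by simpa using h8, by simpa using h9, fun _ _ => rfl, rfl, rfl⟩
  · rintro s' ⟨-, e⟩
    exact e

/-- The number of coordinates that are selected. -/
def selCard (M d2 : ℕ) : ℕ := min M (2 * d2 - 1)

/-- The number of repetitions. -/
def repCount (M dmin d2 : ℕ) : ℕ :=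
  (M.descFactorial dmin / (selCard M d2).descFactorial dmin + 1) * (4 * (M + 1))

theorem setup_runs {M dmin d2 : ℕ} (h1 : s.reg 1 = M) (h2 : s.reg 2 = dmin) (h3 : s.reg 3 = d2)
    (hK : M * M < S) (hd : dmin ≤ M) (hd2 : d2 ≤ M) (hR : repCount M dmin d2 < 2 ^ S) :
    Runs dec ω setup s ((4 * dmin + 8) * stepTime S) fun s' =>
      s'.reg 4 = selCard M d2 ∧ s'.reg 5 = repCount M dmin d2 ∧
      (∀ q, q < 8 → q ≠ 4 → q ≠ 5 → s'.reg q = s.reg q) ∧ s'.mem = s.mem ∧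
      s'.coins = s.coins := by
  have hR4 : 4 * (M + 1) ≤ repCount M dmin d2 :=
    Nat.le_mul_of_pos_left _ (Nat.succ_pos _)
  have hu : selCard M d2 ≤ M := min_le_left _ _
  refine Runs.mono (T := stepTime S + ((stepTime S + stepTime S) + (stepTime S + (stepTime S +
    (stepTime S + ((4 * dmin + 1) * stepTime S + stepTime S)))))) ?_ (le_of_eq (by ring))
    fun _ h => h
  refine Runs.assign_seq ?_ (by decide) (Runs.seq (Q := fun s₁ => s₁.reg 4 = selCard M d2 ∧
    (∀ q, q < 8 → q ≠ 4 → s₁.reg q = s.reg q) ∧ s₁.mem = s.mem ∧ s₁.coins = s.coins)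
    (Runs.ite ?_ (by decide) ?_ ?_) ?_)
  · simp only [and_true, true_and, Expr.Fits, Op.Fits, Expr.eval, h3]; omega
  · simp only [and_true, true_and, Expr.Fits, Op.Fits, Expr.eval, Op.eval, Nat.reduceEqDiff,
      reduceIte, setReg_reg, h3, h1]
    omega
  · intro hc
    simp only [Expr.eval, Op.eval, Nat.reduceEqDiff, reduceIte, setReg_reg, h3, h1] at hc
    refine Runs.assign ?_ (by decide) ?_
    · simp only [Expr.Fits, Nat.reduceEqDiff, reduceIte, setReg_reg, h1]; omega
    · simp only [Expr.eval, Nat.reduceEqDiff, reduceIte, setReg_reg, setReg_mem, setReg_coins, h1]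
      refine ⟨by rw [selCard]; omega, fun q hq hq' => ?_, trivial, trivial⟩
      rw [if_neg hq', if_neg hq']
  · intro hc
    simp only [Expr.eval, Op.eval, Nat.reduceEqDiff, reduceIte, setReg_reg, h3, h1] at hc
    refine Runs.skip ?_
    simp only [Expr.eval, Op.eval, Nat.reduceEqDiff, reduceIte, setReg_reg, setReg_mem,
      setReg_coins, h3]
    refine ⟨by rw [selCard]; omega, fun q hq hq' => ?_, trivial, trivial⟩
    rw [if_neg hq']
  rintro s₁ ⟨a4, afr, amem, aco⟩
  refine Runs.assign_seq ?_ (by decide) (Runs.assign_seq ?_ (by decide)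
    (Runs.assign_seq ?_ (by decide) (Runs.seq (ratioLoop_runs (M := M) (dmin := dmin)
      (u := selCard M d2) ?_ ?_ ?_ ?_ ?_ ?_ hK hu hd (by omega)) ?_)))
  · simp only [Expr.Fits]; omega
  · simp only [Expr.Fits]; omega
  · simp only [Expr.Fits]; omega
  · simp only [Nat.reduceEqDiff, reduceIte, setReg_reg, afr 1 (by decide) (by decide), h1]
  · simp only [Nat.reduceEqDiff, reduceIte, setReg_reg, afr 2 (by decide) (by decide), h2]
  · simp only [Nat.reduceEqDiff, reduceIte, setReg_reg, a4]
  · simp only [Expr.eval, Nat.reduceEqDiff, reduceIte, setReg_reg]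
  · simp only [Expr.eval, Nat.reduceEqDiff, reduceIte, setReg_reg]
  · simp only [Expr.eval, Nat.reduceEqDiff, reduceIte, setReg_reg]
  rintro s₂ ⟨b8, b9, bfr, bmem, bco⟩
  have bfr' : ∀ q, q < 8 → s₂.reg q = s₁.reg q := by
    intro q hq
    rw [bfr q hq, setReg_reg, setReg_reg, setReg_reg, if_neg (by omega), if_neg (by omega),
      if_neg (by omega)]
  have b1 : s₂.reg 1 = M := by rw [bfr' 1 (by decide), afr 1 (by decide) (by decide), h1]
  have c1 : M.descFactorial dmin < 2 ^ S := descFactorial_lt_two_pow le_rfl hd hK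
  have c2 : (selCard M d2).descFactorial dmin < 2 ^ S := descFactorial_lt_two_pow hu hd hK
  have c3 : M.descFactorial dmin / (selCard M d2).descFactorial dmin + 1 ≤ repCount M dmin d2 :=
    Nat.le_mul_of_pos_right _ (by omega)
  simp only [setReg_mem] at bmem
  simp only [setReg_coins] at bco
  refine Runs.assign ?_ (by decide) ?_
  · simp only [and_true, true_and, Expr.Fits, Op.Fits, Expr.eval, Op.eval, b8, b9, b1]
    rw [repCount] at hR hR4 c3
    refine ⟨⟨⟨c1, c2⟩, ?_, ?_⟩, ⟨?_, ⟨?_, ?_, ?_⟩, ?_⟩, hR⟩ <;> omega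
  · simp only [Expr.eval, Op.eval, Nat.reduceEqDiff, reduceIte, setReg_reg, setReg_mem,
      setReg_coins, b8, b9, b1]
    refine ⟨by rw [bfr' 4 (by decide), a4], rfl, fun q q1 q2 q3 => ?_, by rw [bmem, amem],
      by rw [bco, aco]⟩
    rw [if_neg q3, bfr' q q1, afr q q1 q2]

end Loops

/-! ### Correctness on a gapped instance -/

section Instance

variable {n m : ℕ} {x : Fin n → Cube m} {a b : Fin n} {dmin d2 : ℕ}

/-- The entries of the vectors as natural numbers, extended by `0`. -/
def entry (x : Fin n → Cube m) (i p : ℕ) : ℕ :=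
  if h : i < n ∧ p < m then (x ⟨i, h.1⟩ ⟨p, h.2⟩).toNat else 0

theorem entry_le_one (x : Fin n → Cube m) (i p : ℕ) : entry x i p ≤ 1 := by
  rw [entry]
  split_ifs
  · exact Bool.toNat_le _
  · exact Nat.zero_le _

theorem entry_coe (x : Fin n → Cube m) (i : Fin n) (p : Fin m) : entry x i p = (x i p).toNat := by
  rw [entry, dif_pos ⟨i.2, p.2⟩]

theorem entry_eq_entry_iff (x : Fin n → Cube m) (i j : Fin n) (p : Fin m) :
    entry x i p = entry x j p ↔ x i p = x j p := by
  rw [entry_coe, entry_coe]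
  cases x i p <;> cases x j p <;> simp

theorem initState_mem (x : Fin n → Cube m) (dmin d2 : ℕ) {i p : ℕ} (hi : i < n) (hp : p < m) :
    (initState x dmin d2).mem (i * m + p) = entry x i p := by
  have hlt : i * m + p < n * m := by
    calc i * m + p < (i + 1) * m := by rw [add_mul]; omega
      _ ≤ n * m := Nat.mul_le_mul_right _ hi
  have h1 : (i * m + p) / m = i := by
    rw [mul_comm, Nat.mul_add_div (by omega), Nat.div_eq_of_lt hp, add_zero]
  have h2 : (i * m + p) % m = p := by
    rw [mul_comm, Nat.mul_add_mod, Nat.mod_eq_of_lt hp]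
  have h3 : Fin.divNat (⟨i * m + p, hlt⟩ : Fin (n * m)) = ⟨i, hi⟩ := Fin.ext h1
  have h4 : Fin.modNat (⟨i * m + p, hlt⟩ : Fin (n * m)) = ⟨p, hp⟩ := Fin.ext h2
  simp only [initState]
  rw [dif_pos hlt, h3, h4, entry, dif_pos ⟨hi, hp⟩]

theorem natDist_entry (x : Fin n → Cube m) (i j : Fin n) :
    natDist m (entry x i) (entry x j) = hammingDist (x i) (x j) := by
  rw [natDist, Finset.sum_range, hammingDist, Finset.card_filter]
  refine Finset.sum_congr rfl fun p _ => ?_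
  rw [entry_coe, entry_coe]
  cases x i p <;> cases x j p <;> simp

/-- The coordinates in which the vectors `x a` and `x b` differ. -/
def diffSet (x : Fin n → Cube m) (a b : Fin n) : Finset ℕ :=
  (Finset.univ.filter fun k => x a k ≠ x b k).map Fin.valEmbedding

theorem card_diffSet (x : Fin n → Cube m) (a b : Fin n) :
    (diffSet x a b).card = hammingDist (x a) (x b) := by
  rw [diffSet, Finset.card_map, hammingDist]

theorem diffSet_subset (x : Fin n → Cube m) (a b : Fin n) : diffSet x a b ⊆ Finset.range m := by
  intro k hk
  obtain ⟨q, -, rfl⟩ := Finset.mem_map.1 hk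
  exact Finset.mem_range.2 q.2

/-- Equal keys mean agreement outside the selection, which has fewer than `2 * d2` elements, so the
Plotkin bound applies. -/
theorem bucket_length_le_of_gapped (h : IsGappedInstance x a b dmin d2) (r ρ i : ℕ) (hi : i < n) :
    (bucket (fun j => keyNum (entry x j) m (selCard m d2) r ρ) i
      (keyNum (entry x i) m (selCard m d2) r ρ)).length ≤ 2 * d2 + 1 := by
  classical
  set L := bucket (fun j => keyNum (entry x j) m (selCard m d2) r ρ) i
    (keyNum (entry x i) m (selCard m d2) r ρ) with hL
  have hnd : L.Nodup := List.nodup_range.filter _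
  set I : Finset (Fin n) := Finset.univ.filter fun j => (j : ℕ) ∈ L
  set U : Finset (Fin m) := Finset.univ.filter fun k => (k : ℕ) ∈ selSet m (selCard m d2) r
  have hLI : L.length ≤ I.card := by
    rw [← List.toFinset_card_of_nodup hnd]
    refine (Finset.card_le_card (t := I.image Fin.val) fun j hj => ?_).trans Finset.card_image_le
    have hjL := List.mem_toFinset.1 hj
    have hjn : j < n := (mem_bucket.1 hjL).1.trans hi
    exact Finset.mem_image.2 ⟨⟨j, hjn⟩, Finset.mem_filter.2 ⟨Finset.mem_univ _, hjL⟩, rfl⟩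
  have hU : U.card ≤ selCard m d2 := by
    refine le_trans ?_ (card_selSet_le m (selCard m d2) r)
    exact Finset.card_le_card_of_injOn Fin.val (fun k hk => (Finset.mem_filter.1 hk).2)
      Fin.val_injective.injOn
  have hsel : selCard m d2 ≤ 2 * d2 - 1 := min_le_right _ _
  have hd := h.2.2.1
  refine hLI.trans (h.card_bucket_le I U (by omega) fun j hj k hk p hp => ?_)
  have h1 := (mem_bucket.1 (Finset.mem_filter.1 hj).2).2
  have h2 := (mem_bucket.1 (Finset.mem_filter.1 hk).2).2
  have h3 := ((keyNum_eq_iff (entry_le_one x j) (entry_le_one x k) _ _ _ _ _).1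
    (h1.trans h2.symm)).2 p p.2 fun hmem => hp (Finset.mem_filter.2 ⟨Finset.mem_univ _, hmem⟩)
  exact (entry_eq_entry_iff x j k p).1 h3

/-- A bound for the bit lengths of all numbers that occur. -/
def bitBound (m : ℕ) : ℕ := 5 * (m + 1) ^ 2

/-- The left side is the end of the memory used for buckets. There may be exponentially many cells,
but their addresses have only `O(m ^ 2)` bits, and only these are charged. -/
theorem repCount_mul_le (h : IsGappedInstance x a b dmin d2) :
    (repCount m dmin d2 + 1) * 2 ^ m * (n + 1) ≤ 2 ^ bitBound m := by
  have hd := h.2.2.1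
  have hd2 := h.d2_le
  have hn := h.card_le_two_pow
  have h1 : m.descFactorial dmin / (selCard m d2).descFactorial dmin + 1 ≤ 2 ^ (m * m + 1) := by
    have : m.descFactorial dmin < 2 ^ (m * m + 1) :=
      descFactorial_lt_two_pow le_rfl (by omega) (Nat.lt_succ_self _)
    have := Nat.div_le_self (m.descFactorial dmin) ((selCard m d2).descFactorial dmin)
    omega
  have hm : m < 2 ^ m := Nat.lt_two_pow_self
  have h2 : 4 * (m + 1) ≤ 2 ^ (m + 2) := by rw [pow_add]; omega
  have h3 : repCount m dmin d2 + 1 ≤ 2 ^ (m * m + m + 4) := by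
    have h4 : repCount m dmin d2 ≤ 2 ^ (m * m + 1) * 2 ^ (m + 2) := Nat.mul_le_mul h1 h2
    have h5 : 2 ^ (m * m + m + 4) = 2 * (2 ^ (m * m + 1) * 2 ^ (m + 2)) := by ring
    have h6 : 0 < 2 ^ (m * m + 1) * 2 ^ (m + 2) := by positivity
    omega
  have h4 : n + 1 ≤ 2 ^ (m + 2) := by rw [pow_add]; omega
  calc (repCount m dmin d2 + 1) * 2 ^ m * (n + 1)
      ≤ 2 ^ (m * m + m + 4) * 2 ^ m * 2 ^ (m + 2) :=
        Nat.mul_le_mul (Nat.mul_le_mul_right _ h3) h4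
    _ = 2 ^ (m * m + m + 4 + m + (m + 2)) := by rw [← pow_add, ← pow_add]
    _ ≤ 2 ^ bitBound m := Nat.pow_le_pow_right (by norm_num) (by
        rw [bitBound]
        have : 1 ≤ m := by omega
        nlinarith)

/-- The running time of the program. -/
def totalTime (n m dmin d2 : ℕ) : ℕ :=
  (4 * dmin + repCount m dmin d2 * repSteps n m (2 * d2 + 1) + 11) * stepTime (bitBound m)

theorem program_runs (h : IsGappedInstance x a b dmin d2) (dec : Cube m → Cube m) (ω : ℕ → Bool) :
    Runs dec ω program (initState x dmin d2) (totalTime n m dmin d2) fun s' =>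
      (∃ k < repCount m dmin d2, diffSet x a b ⊆
        selSet m (selCard m d2) (coinNum ω (k * (m * m)) (m * m))) → Outputs s' a b := by
  have hd := h.2.2.1
  have hd2 := h.d2_le
  have hV := repCount_mul_le h
  have hK : m * m < bitBound m := by rw [bitBound]; nlinarith
  have hRS : repCount m dmin d2 < 2 ^ bitBound m := by
    refine lt_of_lt_of_le (Nat.lt_succ_self _) (le_trans ?_ hV)
    rw [mul_assoc]
    exact Nat.le_mul_of_pos_right _ (by positivity)
  have hnS : n < 2 ^ bitBound m := by
    refine lt_of_lt_of_le (Nat.lt_succ_self _) (le_trans ?_ hV)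
    exact Nat.le_mul_of_pos_left _ (by positivity)
  refine Runs.mono (T := (4 * dmin + 8) * stepTime (bitBound m) +
    ((repCount m dmin d2 * repSteps n m (2 * d2 + 1) + 1) * stepTime (bitBound m) +
      (stepTime (bitBound m) + stepTime (bitBound m)))) ?_ (le_of_eq (by rw [totalTime]; ring))
      fun _ h => h
  refine Runs.seq (setup_runs (M := m) (dmin := dmin) (d2 := d2) rfl rfl rfl hK (by omega) hd2 hRS)
    ?_
  rintro s₁ ⟨a4, a5, afr, amem, aco⟩
  refine Runs.seq (repLoop_runs (n := n) (M := m) (dmin := dmin) (u := selCard m d2)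
    (R := repCount m dmin d2) (B := 2 * d2 + 1) (x := entry x)
    (F := fun i j => (i = (a : ℕ) ∧ j = (b : ℕ)) ∨ (i = (b : ℕ) ∧ j = (a : ℕ)))
    ?_ ?_ ?_ a4 a5 ?_ ?_ ?_ ?_ (entry_le_one x) ?_ (bucket_length_le_of_gapped h) ?_ hV hK
    (min_le_left _ _) (by omega)) ?_
  · rw [afr 0 (by decide) (by decide) (by decide)]; rfl
  · rw [afr 1 (by decide) (by decide) (by decide)]; rfl
  · rw [afr 2 (by decide) (by decide) (by decide)]; rfl
  · rw [afr 6 (by decide) (by decide) (by decide)]; exact Nat.zero_le n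
  · rw [afr 7 (by decide) (by decide) (by decide)]; exact Nat.zero_le n
  · rw [aco]; rfl
  · intro j hj p hp
    rw [amem, initState_mem x dmin d2 hj hp]
  · intro c hc
    rw [amem]
    exact dif_neg (by omega)
  · intro i hi j hj hdist
    have h1 := natDist_entry x ⟨i, hi⟩ ⟨j, hj.trans hi⟩
    simp only at h1
    rw [h1] at hdist
    have hne : (⟨i, hi⟩ : Fin n) ≠ ⟨j, hj.trans hi⟩ := fun he => by
      rw [Fin.mk.injEq] at he
      omega
    have h2 := h.eq_of_dist_le hne hdist
    simpa only [Fin.ext_iff] using h2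
  rintro s₂ ⟨b6, b7, bF⟩
  refine Runs.assign_seq ?_ (by decide) (Runs.assign ?_ (by decide) ?_)
  · exact lt_of_le_of_lt b6 hnS
  · simp only [Expr.Fits, Nat.reduceEqDiff, reduceIte, setReg_reg]
    exact lt_of_le_of_lt b7 hnS
  · rintro ⟨k, hk, hsub⟩
    -- A vector is compared with earlier ones only; as `a < b`, the pair is met when `b` is
    -- processed.
    have h1 := bF ⟨k, hk, b, b.2, a, h.1, fun q hq hsel => ?_, ?_⟩
    · simpa only [Outputs, Expr.eval, Nat.reduceEqDiff, reduceIte, setReg_reg] using h1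
    · by_contra hne
      refine hsel (hsub (Finset.mem_map.2 ⟨⟨q, hq⟩, Finset.mem_filter.2 ⟨Finset.mem_univ _, ?_⟩, rfl⟩))
      exact fun he => hne ((entry_eq_entry_iff x a b ⟨q, hq⟩).2 he)
    · rw [natDist_entry, hammingDist_comm, h.2.1]

/-! ### The probability of success -/

theorem selCard_descFactorial_pos (h : IsGappedInstance x a b dmin d2) :
    0 < (selCard m d2).descFactorial dmin := by
  have hd := h.2.2.1
  have hd2 := h.d2_le
  rw [Nat.descFactorial_pos, selCard]
  omega

theorem factorial_le_two_pow_mul_self (m : ℕ) : m.factorial ≤ 2 ^ (m * m) :=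
  calc m.factorial ≤ m ^ m := Nat.factorial_le_pow m
    _ ≤ (2 ^ m) ^ m := Nat.pow_le_pow_left Nat.lt_two_pow_self.le m
    _ = 2 ^ (m * m) := (pow_mul 2 m m).symm

/-- One block succeeds with probability `p ≥ (u)_dmin / (2 (m)_dmin)`, so the number of repetitions
makes `p * R ≥ 2 (m + 1)` and the failure probability at most `exp (-2 (m + 1))`. -/
theorem le_coinLaw_success (h : IsGappedInstance x a b dmin d2) :
    1 - 1 / (n : ℝ) ^ 2 ≤ coinLaw.real {ω | ∃ k < repCount m dmin d2, diffSet x a b ⊆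
        selSet m (selCard m d2) (coinNum ω (k * (m * m)) (m * m))} := by
  set R := repCount m dmin d2 with hR
  set u := selCard m d2 with hu
  set G := (Finset.range (2 ^ (m * m))).filter fun r => diffSet x a b ⊆ selSet m u r with hG
  have hcard : (diffSet x a b).card = dmin := by rw [card_diffSet, h.2.1]
  have hupos : (0 : ℝ) < u.descFactorial dmin := by
    exact_mod_cast selCard_descFactorial_pos h
  have hdm : dmin ≤ m := h.2.2.1.le.trans h.d2_le
  have hmpos : (0 : ℝ) < m.descFactorial dmin := by
    exact_mod_cast Nat.descFactorial_pos.2 hdm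
  have hp : (2 : ℝ) ^ (m * m) * u.descFactorial dmin ≤ 2 * m.descFactorial dmin * G.card := by
    have := mul_descFactorial_le_card_subset_selSet (min_le_left m (2 * d2 - 1))
      (factorial_le_two_pow_mul_self m) _ (diffSet_subset x a b)
    rw [hcard] at this
    exact_mod_cast this
  -- The `+ 1` in the number of repetitions compensates for rounding the quotient down.
  have hRle : 4 * ((m : ℝ) + 1) * m.descFactorial dmin ≤ R * u.descFactorial dmin := by
    have h1 := Nat.lt_succ_floor ((m.descFactorial dmin : ℝ) / u.descFactorial dmin)
    rw [Nat.floor_div_eq_div, div_lt_iff₀ hupos] at h1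
    have h2 : (R : ℝ) = ((m.descFactorial dmin / u.descFactorial dmin : ℕ) + 1) *
        (4 * ((m : ℝ) + 1)) := by
      rw [hR, repCount]
      push_cast
      rfl
    push_cast at h1
    rw [h2]
    calc 4 * ((m : ℝ) + 1) * m.descFactorial dmin
        ≤ 4 * ((m : ℝ) + 1) * (((m.descFactorial dmin / u.descFactorial dmin : ℕ) + 1) *
          u.descFactorial dmin) := by gcongr
      _ = _ := by ring
  set p : ℝ := (G.card : ℝ) / 2 ^ (m * m) with hpdef
  have hpR : 2 * ((m : ℝ) + 1) ≤ p * R := by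
    have h1 : (u.descFactorial dmin : ℝ) ≤ 2 * m.descFactorial dmin * p := by
      rw [hpdef, mul_div_assoc', le_div_iff₀ (by positivity)]
      linarith
    have h2 : 4 * ((m : ℝ) + 1) * m.descFactorial dmin ≤ R * (2 * m.descFactorial dmin * p) :=
      hRle.trans (by gcongr)
    have h3 : 2 * m.descFactorial dmin * (2 * ((m : ℝ) + 1)) ≤
        2 * m.descFactorial dmin * (p * R) := by linarith
    exact le_of_mul_le_mul_left h3 (by positivity)
  have hle : G.card ≤ 2 ^ (m * m) := by
    simpa using Finset.card_le_card (Finset.filter_subset _ _ : G ⊆ Finset.range (2 ^ (m * m)))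
  have hp1 : p ≤ 1 := by
    rw [hpdef, div_le_one (by positivity)]
    exact_mod_cast hle
  have hn0 : (0 : ℝ) < n := by
    have := h.two_lt
    have : 0 < n := by omega
    exact_mod_cast this
  have hn : (n : ℝ) ≤ Real.exp (m + 1) := by
    have h1 : n ≤ 2 ^ (m + 1) := by
      have := h.card_le_two_pow
      have : 0 < 2 ^ m := by positivity
      rw [pow_succ]
      omega
    have h2 : (2 : ℝ) ≤ Real.exp 1 := by
      have := Real.add_one_le_exp (1 : ℝ)
      linarith
    calc (n : ℝ) ≤ 2 ^ (m + 1) := by exact_mod_cast h1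
      _ ≤ Real.exp 1 ^ (m + 1) := by gcongr
      _ = Real.exp (m + 1) := by
          rw [← Real.exp_nat_mul]
          push_cast
          rw [mul_one]
  have hfail : (1 - p) ^ R ≤ 1 / (n : ℝ) ^ 2 := by
    calc (1 - p) ^ R ≤ Real.exp (-p) ^ R :=
          pow_le_pow_left₀ (by linarith) (Real.one_sub_le_exp_neg p) R
      _ = Real.exp (-(p * R)) := by
          rw [← Real.exp_nat_mul]
          congr 1
          ring
      _ ≤ Real.exp (-(2 * ((m : ℝ) + 1))) := by gcongr
      _ = 1 / Real.exp (m + 1) ^ 2 := by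
          rw [Real.exp_neg, ← Real.exp_nat_mul, one_div]
          norm_num
      _ ≤ 1 / (n : ℝ) ^ 2 := by gcongr
  have hblock := le_coinLaw_exists_block (m * m) R G (Finset.filter_subset _ _)
  have hset : {ω : ℕ → Bool | ∃ ρ < R, coinNum ω (ρ * (m * m)) (m * m) ∈ G} =
      {ω | ∃ k < R, diffSet x a b ⊆ selSet m u (coinNum ω (k * (m * m)) (m * m))} := by
    ext ω
    have : ∀ k, coinNum ω (k * (m * m)) (m * m) ∈ G ↔
        diffSet x a b ⊆ selSet m u (coinNum ω (k * (m * m)) (m * m)) := by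
      intro k
      rw [hG, Finset.mem_filter, Finset.mem_range]
      exact ⟨fun h => h.2, fun h => ⟨coinNum_lt _ _ _, h⟩⟩
    show (∃ ρ < R, coinNum ω (ρ * (m * m)) (m * m) ∈ G) ↔ _
    simp only [this]
    rfl
  rw [hset] at hblock
  linarith

/-! ### The running time -/

/-- The constant is `51 * 7200`. The setup and the final steps are absorbed because there are at
least `m + 1` repetitions. -/
theorem totalTime_le (h : IsGappedInstance x a b dmin d2) :
    totalTime n m dmin d2 ≤ 367200 * (repCount m dmin d2 * n * (m + 1) ^ 6) := by
  have hd := h.2.2.1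
  have hd2 := h.d2_le
  have hn := h.two_lt
  have hR : m + 1 ≤ repCount m dmin d2 :=
    le_trans (by omega) (Nat.le_mul_of_pos_left (4 * (m + 1)) (Nat.succ_pos _))
  have hw : stepTime (bitBound m) ≤ 7200 * (m + 1) ^ 4 := by
    have h1 : bitBound m + 1 ≤ 6 * (m + 1) ^ 2 := by rw [bitBound]; nlinarith
    calc stepTime (bitBound m) ≤ 200 * (6 * (m + 1) ^ 2) ^ 2 :=
          Nat.mul_le_mul_left _ (Nat.pow_le_pow_left h1 2)
      _ = _ := by ring
  have hs : repSteps n m (2 * d2 + 1) ≤ 40 * (n * (m + 1) ^ 2) := by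
    have h1 : 6 * m + 10 + (2 * d2 + 1) * (3 * m + 9) ≤ 29 * (m + 1) ^ 2 := by
      have : (2 * d2 + 1) * (3 * m + 9) ≤ (2 * m + 1) * (3 * m + 9) :=
        Nat.mul_le_mul_right _ (by omega)
      nlinarith
    have h2 : n * (6 * m + 10 + (2 * d2 + 1) * (3 * m + 9)) ≤ n * (29 * (m + 1) ^ 2) :=
      Nat.mul_le_mul_left _ h1
    have h3 : 3 * (m + 1) ^ 2 ≤ n * (m + 1) ^ 2 := Nat.mul_le_mul_right _ hn
    rw [repSteps]
    nlinarith
  have ht : 4 * dmin + repCount m dmin d2 * repSteps n m (2 * d2 + 1) + 11 ≤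
      51 * (repCount m dmin d2 * (n * (m + 1) ^ 2)) := by
    have h1 := Nat.mul_le_mul_left (repCount m dmin d2) hs
    have h2 : (m + 1) * 1 ≤ repCount m dmin d2 * (n * (m + 1) ^ 2) :=
      Nat.mul_le_mul hR (Nat.mul_pos (by omega) (by positivity))
    nlinarith
  calc totalTime n m dmin d2
      ≤ 51 * (repCount m dmin d2 * (n * (m + 1) ^ 2)) * (7200 * (m + 1) ^ 4) :=
        Nat.mul_le_mul ht hw
    _ = _ := by ring

/-- The factor `(log₂ n) ^ 2` is only needed to be at least `1`, which follows from `n > 2`: the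
repetitions for amplification are already counted in the power of `m`. -/
theorem totalTime_le_timeBound (h : IsGappedInstance x a b dmin d2) {γ : ℝ}
    (hγ : (m.descFactorial dmin : ℝ) ≤
      2 * (m + 1) * (selCard m d2).descFactorial dmin * 2 ^ (γ * m)) :
    (totalTime n m dmin d2 : ℝ) ≤ timeBound (367200 * 16 * 256) 8 γ n m := by
  have hd := h.2.2.1
  have hd2 := h.d2_le
  have hn := h.two_lt
  have hupos : (0 : ℝ) < (selCard m d2).descFactorial dmin := by
    exact_mod_cast selCard_descFactorial_pos h
  set z : ℝ := 2 ^ (γ * m) with hz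
  have hzpos : 0 < z := by positivity
  set q : ℝ := (m.descFactorial dmin : ℝ) / (selCard m d2).descFactorial dmin with hq
  have hq1 : 1 ≤ q := by
    rw [hq, one_le_div hupos]
    exact_mod_cast Nat.descFactorial_le dmin (min_le_left m (2 * d2 - 1))
  have hqz : q ≤ 2 * (m + 1) * z := by
    rw [hq, div_le_iff₀ hupos]
    linarith
  have hR : (repCount m dmin d2 : ℝ) ≤ 16 * ((m : ℝ) + 1) ^ 2 * z := by
    have h1 : ((m.descFactorial dmin / (selCard m d2).descFactorial dmin : ℕ) : ℝ) ≤ q :=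
      Nat.cast_div_le
    rw [repCount]
    push_cast
    calc (((m.descFactorial dmin / (selCard m d2).descFactorial dmin : ℕ) : ℝ) + 1) *
          (4 * ((m : ℝ) + 1)) ≤ (2 * q) * (4 * ((m : ℝ) + 1)) := by
          gcongr
          linarith
      _ ≤ (2 * (2 * (m + 1) * z)) * (4 * ((m : ℝ) + 1)) := by gcongr
      _ = _ := by ring
  have hm1 : (m : ℝ) + 1 ≤ 2 * m := by
    have : 1 ≤ m := by omega
    have : (1 : ℝ) ≤ m := by exact_mod_cast this
    linarith
  have hlog : 1 ≤ Real.logb 2 n ^ 2 := by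
    have h1 : (1 : ℝ) ≤ Real.logb 2 n := by
      rw [Real.le_logb_iff_rpow_le one_lt_two (by positivity), Real.rpow_one]
      exact_mod_cast hn.le
    nlinarith
  calc (totalTime n m dmin d2 : ℝ)
      ≤ 367200 * (repCount m dmin d2 * n * ((m : ℝ) + 1) ^ 6) := by
        exact_mod_cast totalTime_le h
    _ ≤ 367200 * (16 * ((m : ℝ) + 1) ^ 2 * z * n * ((m : ℝ) + 1) ^ 6) := by gcongr
    _ = 367200 * 16 * (n * z) * ((m : ℝ) + 1) ^ 8 := by ring
    _ ≤ 367200 * 16 * (n * z) * (2 * (m : ℝ)) ^ 8 := by gcongr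
    _ = 367200 * 16 * 256 * (n * 1 * z * (m : ℝ) ^ 8) := by ring
    _ ≤ 367200 * 16 * 256 * (n * Real.logb 2 n ^ 2 * z * (m : ℝ) ^ 8) := by gcongr
    _ = _ := by rw [timeBound]; push_cast; ring

theorem program_findsPair (h : IsGappedInstance x a b dmin d2) (dec : Cube m → Cube m) {γ : ℝ}
    (hγ : (m.descFactorial dmin : ℝ) ≤
      2 * (m + 1) * (selCard m d2).descFactorial dmin * 2 ^ (γ * m)) :
    FindsPair dec program x a b dmin d2 (timeBound (367200 * 16 * 256) 8 γ n m) := by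
  constructor
  · intro ω
    obtain ⟨s, t, hx, ht, -⟩ := program_runs h dec ω
    refine ⟨s, t, hx, le_trans ?_ (totalTime_le_timeBound h hγ)⟩
    exact_mod_cast ht
  · refine (le_coinLaw_success h).trans (MeasureTheory.measureReal_mono fun ω hω => ?_)
    obtain ⟨s, t, hx, -, hs⟩ := program_runs h dec ω
    exact ⟨s, t, hx, hs hω⟩

/-! ### The exponents -/

theorem descFactorial_le_of_two_mul_le {γ : ℝ} (h : IsGappedInstance x a b dmin d2)
    (hm : 2 * d2 ≤ m)
    (hγ : H2 ((d2 : ℝ) / m) - midExponent ((dmin : ℝ) / m) ((d2 : ℝ) / m) ≤ γ) :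
    (m.descFactorial dmin : ℝ) ≤
      2 * (m + 1) * (selCard m d2).descFactorial dmin * 2 ^ (γ * m) := by
  have hsel : selCard m d2 = 2 * d2 - 1 := min_eq_right (by omega)
  rw [hsel]
  refine (descFactorial_le_exponent h.2.2.1 hm).trans ?_
  gcongr
  norm_num

/-- All coordinates are selected, both falling factorials coincide, and only the exponential factor
has to be controlled. -/
theorem descFactorial_le_of_lt_two_mul {γ : ℝ} (hm : m < 2 * d2)
    (hγ : 1 ≤ 2 * ((m : ℝ) + 1) * 2 ^ (γ * m)) :
    (m.descFactorial dmin : ℝ) ≤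
      2 * (m + 1) * (selCard m d2).descFactorial dmin * 2 ^ (γ * m) := by
  have hsel : selCard m d2 = m := min_eq_left (by omega)
  rw [hsel]
  calc (m.descFactorial dmin : ℝ) = m.descFactorial dmin * 1 := (mul_one _).symm
    _ ≤ m.descFactorial dmin * (2 * ((m : ℝ) + 1) * 2 ^ (γ * m)) := by gcongr
    _ = _ := by ring

theorem div_le_one_of_gapped (h : IsGappedInstance x a b dmin d2) :
    (0 : ℝ) < m ∧ (dmin : ℝ) / m ≤ 1 ∧ (d2 : ℝ) / m ≤ 1 := by
  have hd := h.2.2.1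
  have hd2 := h.d2_le
  have hm : (0 : ℝ) < m := by
    have : 0 < m := by omega
    exact_mod_cast this
  refine ⟨hm, ?_, ?_⟩
  · rw [div_le_one hm]
    exact_mod_cast (hd.le.trans hd2)
  · rw [div_le_one hm]
    exact_mod_cast hd2

theorem half_le_div_of_lt {m d2 : ℕ} (hm0 : (0 : ℝ) < m) (hm : m < 2 * d2) :
    1 / 2 ≤ (d2 : ℝ) / m := by
  rw [div_le_div_iff₀ two_pos hm0]
  have : 1 * m ≤ d2 * 2 := by omega
  exact_mod_cast this

/-- For `2 * d2 ≤ m` the exponent dominates the one of part (b) by `kappaZ_le`; otherwise it is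
nonnegative, since `kappaZ` is at most `0` and the middle exponent at most `1`. -/
theorem descFactorial_le_zyablov (h : IsGappedInstance x a b dmin d2) :
    (m.descFactorial dmin : ℝ) ≤ 2 * (m + 1) * (selCard m d2).descFactorial dmin *
      2 ^ ((1 - kappaZ ((d2 : ℝ) / m) -
        midExponent ((dmin : ℝ) / m) ((d2 : ℝ) / m)) * m) := by
  obtain ⟨hm0, hδ, hδ'⟩ := div_le_one_of_gapped h
  rcases Nat.lt_or_ge m (2 * d2) with hm | hm
  · refine descFactorial_le_of_lt_two_mul hm ?_
    have h1 := kappaZ_nonpos (half_le_div_of_lt hm0 hm) hδ'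
    have h2 := midExponent_le_one (δ' := (d2 : ℝ) / m) hδ
    have h3 : (1 : ℝ) ≤ 2 ^ ((1 - kappaZ ((d2 : ℝ) / m) -
        midExponent ((dmin : ℝ) / m) ((d2 : ℝ) / m)) * m) :=
      Real.one_le_rpow one_le_two (mul_nonneg (by linarith) hm0.le)
    nlinarith
  · refine descFactorial_le_of_two_mul_le h hm ?_
    have := kappaZ_le (δ := (d2 : ℝ) / m) (by positivity) hδ'
    linarith

/-- For `m < 2 * d2` the exponent can be negative. The code bounds the loss: `2 ^ (γ m)` is at least
`1 / C.card` by the Gilbert-Varshamov rate, and `C.card ≤ 2 (m + 1)` by Plotkin. -/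
theorem descFactorial_le_gv (h : IsGappedInstance x a b dmin d2) {C : Finset (Cube m)}
    (hC : IsCode C (d2 + 1)) (hGV : MeetsGV C (d2 + 1)) :
    (m.descFactorial dmin : ℝ) ≤ 2 * (m + 1) * (selCard m d2).descFactorial dmin *
      2 ^ ((H2 ((d2 : ℝ) / m) - midExponent ((dmin : ℝ) / m) ((d2 : ℝ) / m)) * m) := by
  obtain ⟨hm0, hδ, hδ'⟩ := div_le_one_of_gapped h
  rcases Nat.lt_or_ge m (2 * d2) with hm | hm
  · refine descFactorial_le_of_lt_two_mul hm ?_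
    obtain ⟨hne, hrate⟩ := hGV
    have hcard : (C.card : ℝ) ≤ 2 * (m + 1) := by
      have h1 := hC.card_le (by omega)
      have h2 := h.d2_le
      have h3 : C.card ≤ 2 * (m + 1) := by omega
      exact_mod_cast h3
    have hCpos : (0 : ℝ) < C.card := by exact_mod_cast hne.card_pos
    -- The rate is given at `d2 + 1` while the exponent uses `d2`; beyond `1/2` the entropy
    -- decreases, so the shift goes in the right direction.
    have hanti : H2 (((d2 + 1 : ℕ) : ℝ) / m) ≤ H2 ((d2 : ℝ) / m) := by
      refine H2_anti (half_le_div_of_lt hm0 hm) ?_ hδ'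
      gcongr
      simp
    have hmid := midExponent_le_one (δ' := (d2 : ℝ) / m) hδ
    have hlog : -Real.logb 2 C.card ≤
        (H2 ((d2 : ℝ) / m) - midExponent ((dmin : ℝ) / m) ((d2 : ℝ) / m)) * m := by
      rw [codeRate, le_div_iff₀ hm0] at hrate
      nlinarith
    have hpow : (C.card : ℝ)⁻¹ ≤
        2 ^ ((H2 ((d2 : ℝ) / m) - midExponent ((dmin : ℝ) / m) ((d2 : ℝ) / m)) * m) := by
      calc (C.card : ℝ)⁻¹ = 2 ^ (-Real.logb 2 C.card) := by
            rw [Real.rpow_neg two_pos.le, Real.rpow_logb two_pos (by norm_num) hCpos]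
        _ ≤ _ := Real.rpow_le_rpow_of_exponent_le one_le_two hlog
    calc (1 : ℝ) = C.card * (C.card : ℝ)⁻¹ := (mul_inv_cancel₀ hCpos.ne').symm
      _ ≤ _ := mul_le_mul hcard hpow (by positivity) (by positivity)
  · exact descFactorial_le_of_two_mul_le h hm le_rfl

end Instance

end RAM.ClosestPair

theorem theorem3p2 :
    (∃ P : RAM.Cmd, P.OracleFree ∧ ∃ A k : ℕ,
      ∀ (n m : ℕ) (x : Fin n → Cube m) (a b : Fin n) (dmin d2 : ℕ),
        IsGappedInstance x a b dmin d2 →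
        RAM.FindsPair (id : Cube m → Cube m) P x a b dmin d2
          (timeBound A k
            (1 - kappaZ ((d2 : ℝ) / (m : ℝ)) -
              midExponent ((dmin : ℝ) / (m : ℝ)) ((d2 : ℝ) / (m : ℝ))) n m)) ∧
    (∃ P : RAM.Cmd, ∃ A k : ℕ,
      ∀ (n m : ℕ) (x : Fin n → Cube m) (a b : Fin n) (dmin d2 : ℕ),
        IsGappedInstance x a b dmin d2 →
        ∀ C : Finset (Cube m), IsCode C (d2 + 1) → MeetsGV C (d2 + 1) →
        ∀ dec : Cube m → Cube m, IsUniqueDecoder C (d2 + 1) dec →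
        RAM.FindsPair dec P x a b dmin d2
          (timeBound A k
            (H2 ((d2 : ℝ) / (m : ℝ)) -
              midExponent ((dmin : ℝ) / (m : ℝ)) ((d2 : ℝ) / (m : ℝ))) n m)) := by
  refine ⟨⟨RAM.ClosestPair.program, RAM.ClosestPair.program_oracleFree, 367200 * 16 * 256, 8,
    fun n m x a b dmin d2 h => ?_⟩, ⟨RAM.ClosestPair.program, 367200 * 16 * 256, 8,
    fun n m x a b dmin d2 h C hC hGV dec _ => ?_⟩⟩
  · exact RAM.ClosestPair.program_findsPair h id (RAM.ClosestPair.descFactorial_le_zyablov h)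
  · exact RAM.ClosestPair.program_findsPair h dec (RAM.ClosestPair.descFactorial_le_gv h hC hGV)
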